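/- Let $\lambda,\mu>0$ and $q\in\mathbb R$, and let $\mathcal T=\{(x,\xi):0\le\xi\le x\le1\}$. For a parameter vector $\varpi=(m_1,m_2,m_3,m_4)\in\mathbb R^4$ consider the backstepping kernel equations $$\mu\alpha_x-\lambda\alpha_\xi=(m_1-m_4)\alpha+m_3\beta,\qquad \mu\beta_x+\mu\beta_\xi=m_2\alpha \quad\text{in the interior of }\mathcal T,$$ $$\beta(x,0)=q\tfrac{\lambda}{\mu}\,\alpha(x,0),\qquad \alpha(x,x)=-\frac{m_3}{\lambda+\mu}\qquad(0\le x\le1).$$ 1. (Kernel operators.) For every $\varpi\in\mathbb R^4$ there is exactly one pair $(\alpha,\beta)$ of functions that are continuous on $\mathcal T$, continuously differentiable in its interior, and satisfy these equations. Write $\alpha=\Phi_\alpha(\varpi)$ and $\beta=\Phi_\beta(\varpi)$. Fix bounds $\bar m_1,\dots,\bar m_4$ and let $B=\{\varpi:|m_i|\le\bar m_i,\ i=1,\dots,4\}$. 2. (Lipschitz continuity.) There are constants $C_{\bar\alpha},C_{\bar\beta}>0$, depending only on $\lambda,\mu,q$ and $\bar m_1,\dots,\bar m_4$, such that for all $\varpi_1\ne\varpi_2$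 in $B$ $$\|\Phi_\alpha(\varpi_1)-\Phi_\alpha(\varpi_2)\|_\infty<C_{\bar\alpha}\|\varpi_1-\varpi_2\|_\infty,\qquad \|\Phi_\beta(\varpi_1)-\Phi_\beta(\varpi_2)\|_\infty<C_{\bar\beta}\|\varpi_1-\varpi_2\|_\infty ,$$ where the norms are the supremum norm on $\mathcal T$ and the maximum norm on $\mathbb R^4$. 3. (DeepONet approximation.) Let $\mathcal G$ and $\mathcal F$ be two classes of scalar neural networks such that one of the following holds: (a) both have the classical universal approximation property (for every $n$, every compact $K\subset\mathbb R^n$, every continuous $f:K\to\mathbb R$ and every $\varepsilon>0$ the class contains a network with $n$ inputs that is within $\varepsilon$ of $f$ uniformly on $K$); (b) they are the classes of fully connected networks with one hidden layer of arbitrary finite width and with continuous non-polynomial activation functions $\sigma$ and $\tau$, respectively. Let $\Phi$ be $\Phi_\alpha$ or $\Phi_\beta$. Then for every $\varepsilon>0$ there are $m^*,p^*\in\mathbb N$ such that for all $m\ge m^*$ and $p\ge p^*$ there are sensors $x_1,\dots,x_m\in\{1,2,3,4\}$, branch networks $g_1,\dots,g_p\in\mathcal G$ with $m$ inputs and trunk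 networks $f_1,\dots,f_p\in\mathcal F$ with $2$ inputs for which the DeepONet $$\Phi_{\mathcal N}(\varpi)(x,\xi)=\sum_{k=1}^p g_k(\varpi_m)\,f_k(x,\xi),\qquad \varpi_m=(m_{x_1},\dots,m_{x_m}),$$ satisfies $|\Phi(\varpi)(x,\xi)-\Phi_{\mathcal N}(\varpi)(x,\xi)|<\varepsilon$ for all $\varpi\in B$ and all $(x,\xi)\in\mathcal T$. -/

import Mathlib

namespace BacksteppingKernel

/-- The closed triangle `0 ≤ ξ ≤ x ≤ 1`; a point is a pair `(x, ξ)`. -/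
def triangle : Set (ℝ × ℝ) := {z | 0 ≤ z.2 ∧ z.2 ≤ z.1 ∧ z.1 ≤ 1}

theorem isCompact_triangle : IsCompact triangle := by
  have hsub : triangle ⊆ Set.Icc (0 : ℝ × ℝ) 1 := by
    rintro ⟨x, y⟩ ⟨h0, h1, h2⟩
    simp only at h0 h1 h2
    exact ⟨⟨h0.trans h1, h0⟩, ⟨h2, h1.trans h2⟩⟩
  have hclosed : IsClosed triangle :=
    (isClosed_le continuous_const continuous_snd).inter
      ((isClosed_le continuous_snd continuous_fst).inter
        (isClosed_le continuous_fst continuous_const))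
  exact isCompact_Icc.of_isClosed_subset hclosed hsub

/-- Compactness equips `C(triangle, ℝ)` with the supremum norm. -/
instance : CompactSpace triangle := isCompact_iff_compactSpace.mp isCompact_triangle

open Classical in
/-- A function on the triangle, continued by `0` to the plane. It is only differentiated at interior
points of the triangle, where the continuation plays no role. -/
noncomputable def ext (u : C(triangle, ℝ)) (x ξ : ℝ) : ℝ :=
  if h : (x, ξ) ∈ triangle then u ⟨(x, ξ), h⟩ else 0

/-- `(α, β)` is a classical solution (continuous on the closed triangle, continuously differentiable
in its interior) of the kernel equations with transport speeds `lam`, `mu`, boundary parameter `q`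
and parameter vector `w = (m₁, m₂, m₃, m₄) = (w 0, w 1, w 2, w 3)`. -/
structure IsKernel (lam mu q : ℝ) (w : Fin 4 → ℝ) (α β : C(triangle, ℝ)) : Prop where
  contDiffOn_α : ContDiffOn ℝ 1 (fun z : ℝ × ℝ => ext α z.1 z.2) (interior triangle)
  contDiffOn_β : ContDiffOn ℝ 1 (fun z : ℝ × ℝ => ext β z.1 z.2) (interior triangle)
  /-- `μ α_x - λ α_ξ = (m₁ - m₄) α + m₃ β` -/
  eq_α : ∀ x ξ : ℝ, (x, ξ) ∈ interior triangle →
    mu * deriv (fun s => ext α s ξ) x - lam * deriv (fun s => ext α x s) ξ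
      = (w 0 - w 3) * ext α x ξ + w 2 * ext β x ξ
  /-- `μ β_x + μ β_ξ = m₂ α` -/
  eq_β : ∀ x ξ : ℝ, (x, ξ) ∈ interior triangle →
    mu * deriv (fun s => ext β s ξ) x + mu * deriv (fun s => ext β x s) ξ
      = w 1 * ext α x ξ
  /-- `β(x, 0) = q (λ / μ) α(x, 0)` -/
  bottom : ∀ x ∈ Set.Icc (0 : ℝ) 1, ext β x 0 = q * (lam / mu) * ext α x 0
  /-- `α(x, x) = - m₃ / (λ + μ)` -/
  diagonal : ∀ x ∈ Set.Icc (0 : ℝ) 1, ext α x x = -(w 2 / (lam + mu))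

/-- The parameter vectors with `|mᵢ| ≤ bᵢ` for `i = 1, 2, 3, 4`. -/
def paramBox (b : Fin 4 → ℝ) : Set (Fin 4 → ℝ) := {w | ∀ i, |w i| ≤ b i}

/-- A class of scalar neural networks: for every input dimension `n`, the functions `ℝⁿ → ℝ` that
the networks of the class realize. -/
abbrev NetworkClass := (n : ℕ) → Set ((Fin n → ℝ) → ℝ)

/-- The class has the classical universal approximation property: on every compact set, it
approximates every continuous function uniformly. -/
def NetworkClass.IsUniversal (N : NetworkClass) : Prop :=
  ∀ (n : ℕ) (K : Set (Fin n → ℝ)) (f : (Fin n → ℝ) → ℝ), IsCompact K → ContinuousOn f K →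
    ∀ ε : ℝ, 0 < ε → ∃ g ∈ N n, ∀ x ∈ K, |f x - g x| < ε

/-- Fully connected feedforward networks with one hidden layer (of any finite width) and
activation function `σ`. -/
def shallowNetworks (σ : ℝ → ℝ) : NetworkClass := fun n =>
  {g | ∃ (width : ℕ) (c b : Fin width → ℝ) (A : Fin width → Fin n → ℝ),
    ∀ x, g x = ∑ j, c j * σ ((∑ i, A j i * x i) + b j)}

/-- The DeepONet with sensors `s 1, …, s m`, branch networks `g 1, …, g p` and trunk networks
`f 1, …, f p`, evaluated at the input `w` (a function on the index set of the parameters, which the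
branch networks see through its values at the sensors) and at the point `(x, ξ)`. -/
def deepONet {m p : ℕ} (s : Fin m → Fin 4) (g : Fin p → (Fin m → ℝ) → ℝ)
    (f : Fin p → (Fin 2 → ℝ) → ℝ) (w : Fin 4 → ℝ) (x ξ : ℝ) : ℝ :=
  ∑ k, g k (fun i => w (s i)) * f k ![x, ξ]

/-- On the set `D` of parameter vectors, the operator `Φ` is approximated to any accuracy, uniformly
in the parameter vector and in the point of the triangle, by DeepONets with branch networks in `G`
and trunk networks in `F`, for all sufficiently large numbers `m` of sensors and `p` of terms. -/
def DeepONetApproximable (G F : NetworkClass) (D : Set (Fin 4 → ℝ))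
    (Φ : (Fin 4 → ℝ) → C(triangle, ℝ)) : Prop :=
  ∀ ε : ℝ, 0 < ε → ∃ m₀ p₀ : ℕ, ∀ m ≥ m₀, ∀ p ≥ p₀,
    ∃ (s : Fin m → Fin 4) (g : Fin p → (Fin m → ℝ) → ℝ) (f : Fin p → (Fin 2 → ℝ) → ℝ),
      (∀ k, g k ∈ G m) ∧ (∀ k, f k ∈ F 2) ∧
      ∀ w ∈ D, ∀ z : triangle, |Φ w z - deepONet s g f w z.1.1 z.1.2| < ε

end BacksteppingKernel

/-!
The kernel equations are a hyperbolic system with constant coefficients. The second equation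
transports `β` along the lines `x - ξ = const` from the side `ξ = 0`, and the first one transports
`α` along lines on which `x - ξ` decreases to `0`, that is, to the diagonal. Hence `|β|` on a line
`x - ξ = u` is controlled by `|α|` on the same line, and the growth of `|α|` is controlled by its
values at smaller `u`. Measured in the weighted supremum norm with weight `exp (-R (x - ξ))`, `R`
large, this gives the a priori estimate `apriori_estimate`. Applied to differences of solutions it
yields uniqueness and Lipschitz continuity in the parameters (`IsKernel.exists_lipschitz`).

For existence, put `u = x - ξ`, `v = ξ` and describe a function of `v` by the bounded sequence of
its derivatives at `0`. Differentiation in `v` is the shift `S`, passing from `α` to `β` is a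
bounded operator `B`, and the first equation becomes `α_u = T α` with a bounded operator `T`.
The function `exp (v S) exp (u T) c`, read off at the zeroth entry, is therefore a solution on the
whole plane (`exists_goursat_solution`, `exists_isKernel`).

For the approximation by DeepONets, a partition of unity on the compact set of parameters gives
`Φ w ≈ ∑ k, h k w • c k` with finitely many continuous `h k` and `c k`
(`exists_partition_approx`); branch networks approximate the `h k` and trunk networks the `c k`.

It remains to see that shallow networks with a continuous non-polynomial activation function `σ` are
universal (`isUniversal_shallowNetworks`). In one variable, the closure of the networks contains the
mollifications `f` of `σ` and, upon differentiating `f (a x + b)` in `a`, all functions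
`x ^ k * f⁽ᵏ⁾ b`. For each `k` some `f⁽ᵏ⁾ b` is nonzero, because otherwise all mollifications,
and so `σ` as their pointwise limit, would be polynomials of degree less than `k`. So all
polynomials and all continuous functions lie in the closure. In several variables one composes the
exponential function with linear forms and uses the theorem of Stone and Weierstrass.
-/

namespace BacksteppingKernel

/-! ### The a priori estimate along characteristics -/

/-- A mean value inequality that needs no differentiability at the end points. -/
theorem abs_sub_le_of_abs_deriv_le {f f' h h' : ℝ → ℝ} {a b : ℝ} (hab : a ≤ b)
    (hf : ContinuousOn f (Set.Icc a b)) (hh : ContinuousOn h (Set.Icc a b))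
    (hf' : ∀ s ∈ Set.Ioo a b, HasDerivAt f (f' s) s)
    (hh' : ∀ s ∈ Set.Ioo a b, HasDerivAt h (h' s) s)
    (hle : ∀ s ∈ Set.Ioo a b, |f' s| ≤ h' s) : |f b - f a| ≤ h b - h a := by
  have hmono : ∀ g g' : ℝ → ℝ, ContinuousOn g (Set.Icc a b) →
      (∀ s ∈ Set.Ioo a b, HasDerivAt g (g' s) s) → (∀ s ∈ Set.Ioo a b, 0 ≤ g' s) →
      g a ≤ g b := by
    intro g g' hg hg' h0
    refine monotoneOn_of_deriv_nonneg (convex_Icc a b) hg ?_ ?_ (Set.left_mem_Icc.2 hab)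
      (Set.right_mem_Icc.2 hab) hab
    · rw [interior_Icc]
      exact fun s hs => (hg' s hs).differentiableAt.differentiableWithinAt
    · rw [interior_Icc]
      intro s hs
      rw [(hg' s hs).deriv]
      exact h0 s hs
  have h1 := hmono (fun s => h s - f s) (fun s => h' s - f' s) (hh.sub hf)
    (fun s hs => (hh' s hs).sub (hf' s hs))
    (fun s hs => by linarith [(abs_le.1 (hle s hs)).2])
  have h2 := hmono (fun s => h s + f s) (fun s => h' s + f' s) (hh.add hf)
    (fun s hs => (hh' s hs).add (hf' s hs))
    (fun s hs => by linarith [(abs_le.1 (hle s hs)).1])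
  rw [abs_le]
  constructor <;> linarith

theorem mem_interior_triangle {x ξ : ℝ} (h0 : 0 < ξ) (h1 : ξ < x) (h2 : x < 1) :
    (x, ξ) ∈ interior triangle := by
  have ho : IsOpen {z : ℝ × ℝ | 0 < z.2 ∧ z.2 < z.1 ∧ z.1 < 1} :=
    (isOpen_lt continuous_const continuous_snd).inter
      ((isOpen_lt continuous_snd continuous_fst).inter (isOpen_lt continuous_fst continuous_const))
  have hsub : {z : ℝ × ℝ | 0 < z.2 ∧ z.2 < z.1 ∧ z.1 < 1} ⊆ triangle :=
    fun z hz => ⟨hz.1.le, hz.2.1.le, hz.2.2.le⟩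
  exact interior_maximal hsub ho ⟨h0, h1, h2⟩

/-- An inequality between continuous functions need only be checked at the points with
`0 < ξ < x < 1`, which are dense in the triangle. -/
theorem le_on_triangle_of_le {f g : ℝ × ℝ → ℝ} (hf : ContinuousOn f triangle)
    (hg : ContinuousOn g triangle)
    (h : ∀ x ξ : ℝ, 0 < ξ → ξ < x → x < 1 → f (x, ξ) ≤ g (x, ξ)) :
    ∀ z ∈ triangle, f z ≤ g z := by
  rintro ⟨x, ξ⟩ hz
  obtain ⟨h0, h1, h2⟩ : 0 ≤ ξ ∧ ξ ≤ x ∧ x ≤ 1 := hz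
  let c : ℝ → ℝ × ℝ := fun t => ((1 - t) * x + t * (1 / 2), (1 - t) * ξ + t * (1 / 4))
  have hc : Continuous c := by fun_prop
  have hpos : ∀ t ∈ Set.Ioo (0 : ℝ) 1,
      0 < (c t).2 ∧ (c t).2 < (c t).1 ∧ (c t).1 < 1 := by
    intro t ht
    have ht1 : 0 ≤ 1 - t := by linarith [ht.2]
    have e1 := mul_nonneg ht1 h0
    have e2 := mul_nonneg ht1 (sub_nonneg.2 h1)
    have e3 := mul_nonneg ht1 (sub_nonneg.2 h2)
    refine ⟨?_, ?_, ?_⟩ <;> simp only [c] <;> nlinarith [ht.1]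
  have hev : ∀ᶠ t in nhdsWithin (0 : ℝ) (Set.Ioi 0), t ∈ Set.Ioo (0 : ℝ) 1 :=
    Ioo_mem_nhdsGT one_pos
  have hc0 : c 0 = (x, ξ) := by simp [c]
  have hlim : Filter.Tendsto c (nhdsWithin (0 : ℝ) (Set.Ioi 0))
      (nhdsWithin (x, ξ) triangle) := by
    refine tendsto_nhdsWithin_of_tendsto_nhds_of_eventually_within _ ?_ ?_
    · rw [← hc0]
      exact hc.continuousAt.tendsto.mono_left nhdsWithin_le_nhds
    · filter_upwards [hev] with t ht
      exact ⟨(hpos t ht).1.le, (hpos t ht).2.1.le, (hpos t ht).2.2.le⟩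
  refine le_of_tendsto_of_tendsto ((hf _ ⟨h0, h1, h2⟩).tendsto.comp hlim)
    ((hg _ ⟨h0, h1, h2⟩).tendsto.comp hlim) ?_
  filter_upwards [hev] with t ht
  exact h _ _ (hpos t ht).1 (hpos t ht).2.1 (hpos t ht).2.2

/-- Growth along the characteristic `s ↦ (x - ξ + s, s)` of the second equation. -/
theorem abs_le_of_transport_bottom {b : ℝ × ℝ → ℝ} (hb : ContinuousOn b triangle)
    (hb' : ∀ z ∈ interior triangle, DifferentiableAt ℝ b z) {x ξ N : ℝ}
    (h0 : 0 < ξ) (h1 : ξ < x) (h2 : x < 1)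
    (hN : ∀ s ∈ Set.Ioo 0 ξ, |fderiv ℝ b (x - ξ + s, s) (1, 1)| ≤ N) :
    |b (x, ξ)| ≤ |b (x - ξ, 0)| + N * ξ := by
  have hγ : ∀ s : ℝ, HasDerivAt (fun s : ℝ => (x - ξ + s, s)) (1, 1) s := fun s =>
    ((hasDerivAt_id s).const_add _).prodMk (hasDerivAt_id s)
  have key := abs_sub_le_of_abs_deriv_le (f := fun s => b (x - ξ + s, s))
    (f' := fun s => fderiv ℝ b (x - ξ + s, s) (1, 1)) (h := fun s => N * s) (h' := fun _ => N)
    h0.le ?_ (by fun_prop) ?_ ?_ hN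
  · have e : b (x - ξ + ξ, ξ) = b (x, ξ) := by rw [sub_add_cancel]
    simp only [e, add_zero, mul_zero, sub_zero] at key
    have := abs_sub_abs_le_abs_sub (b (x, ξ)) (b (x - ξ, 0))
    linarith
  · refine hb.comp (by fun_prop) fun s hs => ?_
    exact ⟨hs.1, by simp only; linarith, by simp only; linarith [hs.2]⟩
  · intro s hs
    have hi : (x - ξ + s, s) ∈ interior triangle :=
      mem_interior_triangle hs.1 (by linarith) (by linarith [hs.2])
    exact HasFDerivAt.comp_hasDerivAt (f := fun s : ℝ => (x - ξ + s, s)) s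
      (hb' _ hi).hasFDerivAt (hγ s)
  · intro s _
    simpa using (hasDerivAt_id s).const_mul N

/-- Growth along the characteristic `s ↦ (x - mu s, ξ + lam s)` of the first equation, when the
derivative grows at most exponentially in the distance `x - ξ` from the diagonal. -/
theorem abs_le_of_transport_diagonal {lam mu : ℝ} (hlam : 0 < lam) (hmu : 0 < mu)
    {a : ℝ × ℝ → ℝ} (ha : ContinuousOn a triangle)
    (ha' : ∀ z ∈ interior triangle, DifferentiableAt ℝ a z) {x ξ N R δ : ℝ}
    (h0 : 0 < ξ) (h1 : ξ < x) (h2 : x < 1) (hR : 0 < R) (hN0 : 0 ≤ N)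
    (hdiag : ∀ y ∈ Set.Icc (0 : ℝ) 1, |a (y, y)| ≤ δ)
    (hN : ∀ y η : ℝ, 0 < η → η < y → y < 1 →
      |fderiv ℝ a (y, η) (mu, -lam)| ≤ N * Real.exp (R * (y - η))) :
    |a (x, ξ)| ≤ δ + N / (R * (lam + mu)) * Real.exp (R * (x - ξ)) := by
  have hlm : 0 < lam + mu := by positivity
  set S := (x - ξ) / (lam + mu) with hS
  have hS0 : 0 < S := div_pos (by linarith) hlm
  have hSe : S * (lam + mu) = x - ξ := by rw [hS]; field_simp
  have hgap : ∀ s < S, ξ + lam * s < x - mu * s := by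
    intro s hs
    have := mul_lt_mul_of_pos_right hs hlm
    linarith
  have hγ : ∀ s : ℝ, HasDerivAt (fun s : ℝ => (x - mu * s, ξ + lam * s)) (-mu, lam) s := by
    intro s
    refine HasDerivAt.prodMk ?_ ?_
    · simpa using ((hasDerivAt_id s).const_mul mu).const_sub x
    · simpa using ((hasDerivAt_id s).const_mul lam).const_add ξ
  have hneg : ((-mu, lam) : ℝ × ℝ) = -(mu, -lam) := by simp
  have key := abs_sub_le_of_abs_deriv_le (f := fun s => a (x - mu * s, ξ + lam * s))
    (f' := fun s => fderiv ℝ a (x - mu * s, ξ + lam * s) (-mu, lam))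
    (h := fun s => -(N / (R * (lam + mu))) * Real.exp (R * (x - ξ - (lam + mu) * s)))
    (h' := fun s => N * Real.exp (R * (x - ξ - (lam + mu) * s)))
    hS0.le ?_ (by fun_prop) ?_ ?_ ?_
  · have hd : x - mu * S = ξ + lam * S := by linarith
    have hy : ξ + lam * S ∈ Set.Icc (0 : ℝ) 1 :=
      ⟨by positivity, by rw [← hd]; nlinarith [mul_pos hmu hS0]⟩
    have h3 := hdiag _ hy
    simp only [hd, mul_zero, sub_zero, add_zero] at key
    have h4 := abs_sub_abs_le_abs_sub (a (x, ξ)) (a (ξ + lam * S, ξ + lam * S))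
    rw [abs_sub_comm] at h4
    have h5 : 0 ≤ N / (R * (lam + mu)) * Real.exp (R * (x - ξ - (lam + mu) * S)) := by positivity
    linarith
  · refine ha.comp (by fun_prop) fun s hs => ?_
    have e1 := mul_nonneg hlam.le hs.1
    have e2 := mul_nonneg hmu.le hs.1
    have e3 := mul_le_mul_of_nonneg_right hs.2 hlm.le
    exact ⟨by simp only; linarith, by simp only; linarith, by simp only; linarith⟩
  · intro s hs
    have e1 := mul_pos hlam hs.1
    have e2 := mul_pos hmu hs.1
    have hi : (x - mu * s, ξ + lam * s) ∈ interior triangle :=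
      mem_interior_triangle (by linarith) (hgap s hs.2) (by linarith)
    exact HasFDerivAt.comp_hasDerivAt (f := fun s : ℝ => (x - mu * s, ξ + lam * s)) s
      (ha' _ hi).hasFDerivAt (hγ s)
  · intro s _
    have h1 : HasDerivAt (fun s => R * (x - ξ - (lam + mu) * s)) (-(R * (lam + mu))) s := by
      convert! (((hasDerivAt_id s).const_mul (lam + mu)).const_sub (x - ξ)).const_mul R using 1
      ring
    convert! h1.exp.const_mul (-(N / (R * (lam + mu)))) using 1
    field_simp
  · intro s hs
    have h3 := hN (x - mu * s) (ξ + lam * s) (by have := mul_pos hlam hs.1; linarith)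
      (hgap s hs.2) (by have := mul_pos hmu hs.1; linarith)
    rw [hneg, map_neg, abs_neg]
    convert h3 using 3
    ring

/-- The a priori estimate: a pair of functions that solves the kernel equations up to errors of
size `δ` and up to lower-order terms with coefficients bounded by `L` is itself of size `δ`.

The supremum `W` of `exp (-R (x - ξ)) |a|` is estimated by `2 δ + W / 2` once `R` is large. -/
theorem apriori_estimate {lam mu : ℝ} (hlam : 0 < lam) (hmu : 0 < mu) {L : ℝ} (hL : 0 ≤ L) :
    ∃ C > 0, ∀ (δ : ℝ) (a b : ℝ × ℝ → ℝ), 0 ≤ δ →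
      ContinuousOn a triangle → ContinuousOn b triangle →
      (∀ z ∈ interior triangle, DifferentiableAt ℝ a z) →
      (∀ z ∈ interior triangle, DifferentiableAt ℝ b z) →
      (∀ z ∈ interior triangle, |fderiv ℝ a z (mu, -lam)| ≤ L * (|a z| + |b z|) + δ) →
      (∀ z ∈ interior triangle, |fderiv ℝ b z (1, 1)| ≤ L * |a z| + δ) →
      (∀ x ∈ Set.Icc (0 : ℝ) 1, |b (x, 0)| ≤ L * |a (x, 0)|) →
      (∀ x ∈ Set.Icc (0 : ℝ) 1, |a (x, x)| ≤ δ) →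
      ∀ z ∈ triangle, |a z| ≤ C * δ ∧ |b z| ≤ C * δ := by
  have hlm : 0 < lam + mu := by positivity
  -- this makes the coefficient `L (1 + 2 L) / (R (lam + mu))` of `W` at most `1 / 2`
  set R := (2 * (L * (1 + 2 * L)) + (L + 1)) / (lam + mu) with hRdef
  have hRlm : R * (lam + mu) = 2 * (L * (1 + 2 * L)) + (L + 1) := by rw [hRdef]; field_simp
  have hR : 0 < R := by positivity
  refine ⟨(8 * L + 4) * Real.exp R, by positivity, ?_⟩
  intro δ a b hδ hac hbc had hbd hae hbe hbot hdiag
  -- the weighted supremum is attained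
  have hne : triangle.Nonempty := ⟨(0, 0), by simp [triangle]⟩
  have hwc : ContinuousOn (fun z : ℝ × ℝ => |a z| * Real.exp (-(R * (z.1 - z.2)))) triangle :=
    hac.abs.mul (by fun_prop)
  obtain ⟨z₀, hz₀, hmax⟩ := isCompact_triangle.exists_isMaxOn hne hwc
  set W := |a z₀| * Real.exp (-(R * (z₀.1 - z₀.2))) with hW
  have hW0 : 0 ≤ W := by positivity
  have haW : ∀ z ∈ triangle, |a z| ≤ W * Real.exp (R * (z.1 - z.2)) := by
    intro z hz
    have h1 : |a z| * Real.exp (-(R * (z.1 - z.2))) ≤ W := hmax hz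
    have h2 := mul_le_mul_of_nonneg_right h1 (Real.exp_pos (R * (z.1 - z.2))).le
    rwa [mul_assoc, ← Real.exp_add, neg_add_cancel, Real.exp_zero, mul_one] at h2
  have hexp1 : ∀ u : ℝ, 0 ≤ u → 1 ≤ Real.exp (R * u) := fun u hu =>
    Real.one_le_exp (by positivity)
  have hb1 : ∀ x ξ : ℝ, 0 < ξ → ξ < x → x < 1 →
      |b (x, ξ)| ≤ (2 * L * W + δ) * Real.exp (R * (x - ξ)) := by
    intro x ξ h0 h1 h2
    have hu : x - ξ ∈ Set.Icc (0 : ℝ) 1 := ⟨by linarith, by linarith⟩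
    have h3 := abs_le_of_transport_bottom hbc hbd h0 h1 h2
      (N := L * (W * Real.exp (R * (x - ξ))) + δ) (fun s hs => by
        have hi := mem_interior_triangle (x := x - ξ + s) hs.1 (by linarith) (by linarith [hs.2])
        refine (hbe _ hi).trans ?_
        have := haW _ (interior_subset hi)
        simp only [add_sub_cancel_right] at this
        gcongr)
    have h4 := (hbot _ hu).trans (mul_le_mul_of_nonneg_left
      (haW (x - ξ, 0) ⟨le_rfl, hu.1, hu.2⟩) hL)
    simp only [sub_zero] at h4
    have he := hexp1 _ hu.1
    have h5 : (L * (W * Real.exp (R * (x - ξ))) + δ) * ξ ≤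
        L * (W * Real.exp (R * (x - ξ))) + δ :=
      mul_le_of_le_one_right (by positivity) (by linarith)
    have h6 : δ ≤ δ * Real.exp (R * (x - ξ)) := le_mul_of_one_le_right hδ he
    linarith
  have ha1 : ∀ x ξ : ℝ, 0 < ξ → ξ < x → x < 1 →
      |a (x, ξ)| ≤ δ + (L * ((1 + 2 * L) * W + δ) + δ) / (R * (lam + mu)) *
        Real.exp (R * (x - ξ)) := by
    intro x ξ h0 h1 h2
    refine abs_le_of_transport_diagonal hlam hmu hac had h0 h1 h2 hR (by positivity) hdiag ?_
    intro y η k0 k1 k2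
    have hi := mem_interior_triangle k0 k1 k2
    have e1 := haW _ (interior_subset hi)
    have e2 := hb1 y η k0 k1 k2
    have e3 : δ ≤ δ * Real.exp (R * (y - η)) :=
      le_mul_of_one_le_right hδ (hexp1 _ (by linarith))
    have e4 := mul_le_mul_of_nonneg_left (add_le_add e1 e2) hL
    refine (hae _ hi).trans ?_
    simp only at e4 ⊢
    linarith
  have ha2 : ∀ z ∈ triangle, |a z| ≤ (2 * δ + W / 2) * Real.exp (R * (z.1 - z.2)) := by
    refine le_on_triangle_of_le hac.abs (by fun_prop) ?_
    intro x ξ h0 h1 h2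
    refine (ha1 x ξ h0 h1 h2).trans ?_
    have he := hexp1 (x - ξ) (by linarith)
    have e1 : δ ≤ δ * Real.exp (R * (x - ξ)) := le_mul_of_one_le_right hδ he
    have e2 : (L * ((1 + 2 * L) * W + δ) + δ) / (R * (lam + mu)) ≤ δ + W / 2 := by
      rw [hRlm, div_le_iff₀ (by positivity)]
      have : 0 ≤ δ * (2 * (L * (1 + 2 * L))) + W / 2 * (L + 1) := by positivity
      nlinarith
    have e3 := mul_le_mul_of_nonneg_right e2 (Real.exp_pos (R * (x - ξ))).le
    simp only
    linarith
  have hW4 : W ≤ 4 * δ := by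
    have h1 := mul_le_mul_of_nonneg_right (ha2 z₀ hz₀) (Real.exp_pos (-(R * (z₀.1 - z₀.2)))).le
    rw [mul_assoc, ← Real.exp_add, add_neg_cancel, Real.exp_zero, mul_one] at h1
    linarith
  have hexpR : ∀ z ∈ triangle, Real.exp (R * (z.1 - z.2)) ≤ Real.exp R := by
    intro z hz
    refine Real.exp_le_exp.2 (mul_le_of_le_one_right hR.le ?_)
    linarith [hz.1, hz.2.2]
  have hb2 : ∀ z ∈ triangle, |b z| ≤ (2 * L * W + δ) * Real.exp (R * (z.1 - z.2)) :=
    le_on_triangle_of_le hbc.abs (by fun_prop) hb1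
  intro z hz
  have hcoef : 2 * L * W + δ ≤ (8 * L + 4) * δ := by
    have := mul_le_mul_of_nonneg_left hW4 hL
    linarith
  have hcoef' : W ≤ (8 * L + 4) * δ := by
    have := mul_nonneg hL hδ
    linarith
  constructor
  · calc |a z| ≤ W * Real.exp (R * (z.1 - z.2)) := haW z hz
      _ ≤ ((8 * L + 4) * δ) * Real.exp R := by
          exact mul_le_mul hcoef' (hexpR z hz) (Real.exp_pos _).le (by positivity)
      _ = _ := by ring
  · calc |b z| ≤ (2 * L * W + δ) * Real.exp (R * (z.1 - z.2)) := hb2 z hz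
      _ ≤ ((8 * L + 4) * δ) * Real.exp R := by
          exact mul_le_mul hcoef (hexpR z hz) (Real.exp_pos _).le (by positivity)
      _ = _ := by ring

/-! ### Existence by operator exponentials on bounded sequences -/

open BoundedContinuousFunction

section Orbit

variable {X : Type*} [NormedAddCommGroup X] [NormedSpace ℝ X]

/-- The function `(u, v) ↦ π (exp (v S) A exp (u T) c)` of two variables. It has the partial
derivatives of the same form with `A T` and `S A` in place of `A`. -/
noncomputable def orbit (π : X →L[ℝ] ℝ) (S T A : X →L[ℝ] X) (c : X) (p : ℝ × ℝ) : ℝ :=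
  π (NormedSpace.exp (p.2 • S) (A (NormedSpace.exp (p.1 • T) c)))

theorem contDiff_exp_smul [CompleteSpace X] (B : X →L[ℝ] X) :
    ContDiff ℝ 1 fun t : ℝ => NormedSpace.exp (t • B) := by
  have hd := fun t : ℝ => hasDerivAt_exp_smul_const (𝕂 := ℝ) B t
  rw [contDiff_one_iff_deriv]
  refine ⟨fun t => (hd t).differentiableAt, ?_⟩
  rw [funext fun t => (hd t).deriv]
  have : Continuous fun t : ℝ => NormedSpace.exp (t • B) :=
    continuous_iff_continuousAt.2 fun t => (hd t).continuousAt
  exact this.mul continuous_const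

theorem contDiff_orbit [CompleteSpace X] (π : X →L[ℝ] ℝ) (S T A : X →L[ℝ] X) (c : X) :
    ContDiff ℝ 1 (orbit π S T A c) := by
  have h1 : ContDiff ℝ 1 fun p : ℝ × ℝ => NormedSpace.exp (p.2 • S) :=
    (contDiff_exp_smul S).comp contDiff_snd
  have h2 : ContDiff ℝ 1 fun p : ℝ × ℝ => NormedSpace.exp (p.1 • T) :=
    (contDiff_exp_smul T).comp contDiff_fst
  exact π.contDiff.comp (h1.clm_apply (A.contDiff.comp (h2.clm_apply contDiff_const)))

theorem hasFDerivAt_orbit [CompleteSpace X] (π : X →L[ℝ] ℝ) (S T A : X →L[ℝ] X) (c : X)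
    (p : ℝ × ℝ) :
    HasFDerivAt (orbit π S T A c)
      (orbit π S T (A * T) c p • ContinuousLinearMap.fst ℝ ℝ ℝ +
        orbit π S T (S * A) c p • ContinuousLinearMap.snd ℝ ℝ ℝ) p := by
  have h1 : HasFDerivAt (fun p : ℝ × ℝ => NormedSpace.exp (p.2 • S)) _ p :=
    (hasDerivAt_exp_smul_const (𝕂 := ℝ) S p.2).hasFDerivAt.comp p hasFDerivAt_snd
  have h2 : HasFDerivAt (fun p : ℝ × ℝ => NormedSpace.exp (p.1 • T)) _ p :=
    (hasDerivAt_exp_smul_const' (𝕂 := ℝ) T p.1).hasFDerivAt.comp p hasFDerivAt_fst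
  have h3 := π.hasFDerivAt.comp p (h1.clm_apply
    (A.hasFDerivAt.comp p (h2.clm_apply (hasFDerivAt_const c p))))
  refine h3.congr_fderiv ?_
  ext <;> simp [orbit]

theorem orbit_zero_right (π : X →L[ℝ] ℝ) (S T A : X →L[ℝ] X) (c : X) (u : ℝ) :
    orbit π S T A c (u, 0) = π (A (NormedSpace.exp (u • T) c)) := by
  simp [orbit]

/-- On the line `u = 0` the orbit of a vector in the kernel of `S` is constant. -/
theorem orbit_zero_left [CompleteSpace X] (π : X →L[ℝ] ℝ) (S T : X →L[ℝ] X) {c : X}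
    (hc : S c = 0) (v : ℝ) :
    orbit π S T 1 c (0, v) = π c := by
  have hd : ∀ s : ℝ, HasDerivAt (fun s : ℝ => NormedSpace.exp (s • S) c) 0 s := fun s => by
    simpa [hc] using (hasDerivAt_exp_smul_const (𝕂 := ℝ) S s).clm_apply (hasDerivAt_const s c)
  have h := is_const_of_deriv_eq_zero (fun s => (hd s).differentiableAt) (fun s => (hd s).deriv) v 0
  simp only [zero_smul, NormedSpace.exp_zero, one_apply_eq_self] at h
  simp [orbit, h]

/-- If `K T - l S = c₀ + c₁ B`, `S B = r` and `π B = k π`, then the orbits observed through `1`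
and `B` solve a Goursat problem on the plane. -/
theorem orbit_system {π : X →L[ℝ] ℝ} {S T B : X →L[ℝ] X} {K l c₀ c₁ r k : ℝ}
    (hT : K • T = l • S + c₀ • 1 + c₁ • B) (hB : S * B = r • 1) (hπ : ∀ c, π (B c) = k * π c)
    (c : X) (p : ℝ × ℝ) :
    K * orbit π S T T c p - l * orbit π S T S c p =
        c₀ * orbit π S T 1 c p + c₁ * orbit π S T B c p ∧
      orbit π S T (S * B) c p = r * orbit π S T 1 c p ∧
      orbit π S T B c (p.1, 0) = k * orbit π S T 1 c (p.1, 0) := by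
  refine ⟨?_, ?_, ?_⟩
  · have h := congrArg (fun A : X →L[ℝ] X => orbit π S T A c p) hT
    simp only [orbit, _root_.add_apply, _root_.smul_apply, map_add,
      map_smul, smul_eq_mul] at h ⊢
    linarith
  · rw [hB]
    simp [orbit]
  · rw [orbit_zero_right, orbit_zero_right, hπ]
    rfl

end Orbit

/-- Bounded real sequences with the supremum norm; a sequence `c` stands for the function
`v ↦ ∑ j, c j * v ^ j / j!`. -/
abbrev BddSeq := ℕ →ᵇ ℝ

/-- The left shift, which represents differentiation. -/
noncomputable def shift : BddSeq →L[ℝ] BddSeq :=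
  LinearMap.mkContinuous
    { toFun := fun c => ofNormedAddCommGroupDiscrete (fun j => c (j + 1)) ‖c‖
        fun j => c.norm_coe_le_norm (j + 1)
      map_add' := fun _ _ => rfl
      map_smul' := fun _ _ => rfl } 1 fun c => by
        rw [one_mul]
        exact (norm_le (norm_nonneg c)).2 fun j => c.norm_coe_le_norm (j + 1)

/-- The operator `c ↦ (k c₀, r c₀, r c₁, …)`, which represents solving `b' = r a`,
`b 0 = k * a 0` for `b`. -/
noncomputable def integrate (k r : ℝ) : BddSeq →L[ℝ] BddSeq :=
  have bound : ∀ (c : BddSeq) (j : ℕ),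
      ‖(Nat.casesOn j (k * c 0) fun i => r * c i : ℝ)‖ ≤ (|k| + |r|) * ‖c‖ := by
    intro c j
    have h := fun i => c.norm_coe_le_norm i
    cases j with
    | zero =>
      change ‖k * c 0‖ ≤ _
      rw [norm_mul]
      exact mul_le_mul (le_add_of_nonneg_right (abs_nonneg r)) (h 0) (norm_nonneg _) (by positivity)
    | succ i =>
      change ‖r * c i‖ ≤ _
      rw [norm_mul]
      exact mul_le_mul (le_add_of_nonneg_left (abs_nonneg k)) (h i) (norm_nonneg _) (by positivity)
  LinearMap.mkContinuous
    { toFun := fun c => ofNormedAddCommGroupDiscrete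
        (fun j => Nat.casesOn j (k * c 0) fun i => r * c i) ((|k| + |r|) * ‖c‖) (bound c)
      map_add' := fun c d => by
        ext j
        cases j <;> simp [mul_add]
      map_smul' := fun t c => by
        ext j
        cases j <;> simp [mul_left_comm] } (|k| + |r|) fun c =>
      (norm_le (by positivity)).2 (bound c)

theorem shift_integrate (k r : ℝ) (c : BddSeq) : shift (integrate k r c) = r • c := by
  ext j
  rfl

/-- The sequence `(t, 0, 0, …)`, which represents the constant function `t`. -/
noncomputable def constSeq (t : ℝ) : BddSeq :=
  ofNormedAddCommGroupDiscrete (fun j => Nat.casesOn j t fun _ => 0) |t| fun j => by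
    cases j <;> simp

theorem shift_constSeq (t : ℝ) : shift (constSeq t) = 0 := by
  ext j
  rfl

/-- The Goursat problem `K f_u - l f_v = c₀ f + c₁ g`, `g_v = r f`, `g (u, 0) = k f (u, 0)`,
`f (0, v) = t` has a solution on the whole plane. The first equation prescribes the generator `T`
of the evolution in `u`, once `g` is obtained from `f` by integration in `v`. -/
theorem exists_goursat_solution {K : ℝ} (hK : K ≠ 0) (l c₀ c₁ r k t : ℝ) :
    ∃ f g fu fv gu gv : ℝ × ℝ → ℝ, ContDiff ℝ 1 f ∧ ContDiff ℝ 1 g ∧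
      (∀ p, HasFDerivAt f (fu p • ContinuousLinearMap.fst ℝ ℝ ℝ +
        fv p • ContinuousLinearMap.snd ℝ ℝ ℝ) p) ∧
      (∀ p, HasFDerivAt g (gu p • ContinuousLinearMap.fst ℝ ℝ ℝ +
        gv p • ContinuousLinearMap.snd ℝ ℝ ℝ) p) ∧
      (∀ p, K * fu p - l * fv p = c₀ * f p + c₁ * g p) ∧ (∀ p, gv p = r * f p) ∧
      (∀ u, g (u, 0) = k * f (u, 0)) ∧ ∀ v, f (0, v) = t := by
  set B := integrate k r
  set T : BddSeq →L[ℝ] BddSeq := K⁻¹ • (l • shift + c₀ • 1 + c₁ • B) with hTdef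
  set π : BddSeq →L[ℝ] ℝ := evalCLM ℝ 0
  have hT : K • T = l • shift + c₀ • 1 + c₁ • B := smul_inv_smul₀ hK _
  have hB : shift * B = r • 1 := ContinuousLinearMap.ext fun c => shift_integrate k r c
  have hsys := fun p => orbit_system hT hB (π := π) (k := k) (fun c => rfl) (constSeq t) p
  refine ⟨orbit π shift T 1 (constSeq t), orbit π shift T B (constSeq t), _, _, _, _,
    contDiff_orbit _ _ _ _ _, contDiff_orbit _ _ _ _ _, fun p => hasFDerivAt_orbit _ _ _ _ _ p,
    fun p => hasFDerivAt_orbit _ _ _ _ _ p, fun p => ?_, fun p => (hsys p).2.1,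
    fun u => (hsys (u, 0)).2.2, fun v => ?_⟩
  · rw [one_mul, mul_one]
    exact (hsys p).1
  · rw [orbit_zero_left _ _ _ (shift_constSeq t)]
    rfl

/-! ### Well-posedness of the kernel equations and Lipschitz dependence on the parameters -/

/-- The continuation `ext u` as a function of a point of the plane. -/
noncomputable def plane (u : C(triangle, ℝ)) (z : ℝ × ℝ) : ℝ := ext u z.1 z.2

theorem plane_coe (u : C(triangle, ℝ)) (z : triangle) : plane u z = u z :=
  dif_pos z.2

theorem continuousOn_plane (u : C(triangle, ℝ)) : ContinuousOn (plane u) triangle := by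
  rw [continuousOn_iff_continuous_domRestrict]
  exact u.continuous.congr fun z => (plane_coe u z).symm

theorem deriv_slice_fst {G : ℝ × ℝ → ℝ} {x ξ : ℝ} (h : DifferentiableAt ℝ G (x, ξ)) :
    deriv (fun s => G (s, ξ)) x = fderiv ℝ G (x, ξ) (1, 0) :=
  (HasFDerivAt.comp_hasDerivAt (f := fun s : ℝ => (s, ξ)) x h.hasFDerivAt
    ((hasDerivAt_id x).prodMk (hasDerivAt_const x ξ))).deriv

theorem deriv_slice_snd {G : ℝ × ℝ → ℝ} {x ξ : ℝ} (h : DifferentiableAt ℝ G (x, ξ)) :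
    deriv (fun s => G (x, s)) ξ = fderiv ℝ G (x, ξ) (0, 1) :=
  (HasFDerivAt.comp_hasDerivAt (f := fun s : ℝ => (x, s)) ξ h.hasFDerivAt
    ((hasDerivAt_const ξ x).prodMk (hasDerivAt_id ξ))).deriv

theorem differentiableAt_plane {u : C(triangle, ℝ)}
    (h : ContDiffOn ℝ 1 (fun z : ℝ × ℝ => ext u z.1 z.2) (interior triangle)) {z : ℝ × ℝ}
    (hz : z ∈ interior triangle) : DifferentiableAt ℝ (plane u) z :=
  (h.differentiableOn one_ne_zero z hz).differentiableAt (isOpen_interior.mem_nhds hz)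

section Solution

variable {lam mu q : ℝ} {w : Fin 4 → ℝ} {α β : C(triangle, ℝ)}

theorem IsKernel.fderiv_α (h : IsKernel lam mu q w α β) {z : ℝ × ℝ} (hz : z ∈ interior triangle) :
    fderiv ℝ (plane α) z (mu, -lam) = (w 0 - w 3) * plane α z + w 2 * plane β z := by
  have hd := differentiableAt_plane h.contDiffOn_α hz
  have h1 := h.eq_α z.1 z.2 hz
  have h2 := deriv_slice_fst hd
  have h3 := deriv_slice_snd hd
  simp only [plane, Prod.mk.eta] at h1 h2 h3 ⊢
  rw [← h1, h2, h3]
  have : ((mu, -lam) : ℝ × ℝ) = mu • (1, 0) - lam • (0, 1) := by simp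
  rw [this, map_sub, map_smul, map_smul, smul_eq_mul, smul_eq_mul]

theorem IsKernel.fderiv_β (h : IsKernel lam mu q w α β) {z : ℝ × ℝ} (hz : z ∈ interior triangle) :
    mu * fderiv ℝ (plane β) z (1, 1) = w 1 * plane α z := by
  have hd := differentiableAt_plane h.contDiffOn_β hz
  have h1 := h.eq_β z.1 z.2 hz
  have h2 := deriv_slice_fst hd
  have h3 := deriv_slice_snd hd
  simp only [plane, Prod.mk.eta] at h1 h2 h3 ⊢
  rw [← h1, h2, h3]
  have : ((1, 1) : ℝ × ℝ) = (1, 0) + (0, 1) := by simp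
  rw [this, map_add, mul_add]

end Solution

/-- The kernel functions are bounded uniformly over bounded sets of parameters. -/
theorem IsKernel.exists_bound {lam mu : ℝ} (hlam : 0 < lam) (hmu : 0 < mu) (q : ℝ) {M : ℝ}
    (hM : 0 ≤ M) :
    ∃ A ≥ 0, ∀ (w : Fin 4 → ℝ) (α β : C(triangle, ℝ)), (∀ i, |w i| ≤ M) →
      IsKernel lam mu q w α β → ∀ z ∈ triangle, |plane α z| ≤ A ∧ |plane β z| ≤ A := by
  have hlm : 0 < lam + mu := by positivity
  obtain ⟨C, hC, hest⟩ := apriori_estimate hlam hmu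
    (L := 2 * M + M / mu + |q * (lam / mu)|) (by positivity)
  have hMmu : 0 ≤ M / mu := by positivity
  have hq : 0 ≤ |q * (lam / mu)| := abs_nonneg _
  refine ⟨C * (M / (lam + mu)), by positivity, fun w α β hw h => ?_⟩
  refine hest _ _ _ (by positivity) (continuousOn_plane α) (continuousOn_plane β)
    (fun z hz => differentiableAt_plane h.contDiffOn_α hz)
    (fun z hz => differentiableAt_plane h.contDiffOn_β hz) ?_ ?_ ?_ ?_
  · intro z hz
    rw [h.fderiv_α hz]
    have e1 : |w 0 - w 3| ≤ 2 * M := by linarith [abs_sub (w 0) (w 3), hw 0, hw 3]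
    calc |(w 0 - w 3) * plane α z + w 2 * plane β z|
        ≤ |w 0 - w 3| * |plane α z| + |w 2| * |plane β z| := by
          simpa only [abs_mul] using abs_add_le ((w 0 - w 3) * plane α z) (w 2 * plane β z)
      _ ≤ (2 * M + M / mu + |q * (lam / mu)|) * |plane α z| +
          (2 * M + M / mu + |q * (lam / mu)|) * |plane β z| := by
          gcongr
          · linarith
          · linarith [hw 2]
      _ ≤ _ := by
          have : 0 ≤ M / (lam + mu) := by positivity
          linarith
  · intro z hz
    have e : fderiv ℝ (plane β) z (1, 1) = w 1 / mu * plane α z := by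
      rw [div_mul_eq_mul_div, ← h.fderiv_β hz]
      field_simp
    rw [e, abs_mul, abs_div, abs_of_pos hmu]
    have e1 : |w 1| / mu ≤ M / mu := div_le_div_of_nonneg_right (hw 1) hmu.le
    have e2 := mul_le_mul_of_nonneg_right
      (show |w 1| / mu ≤ 2 * M + M / mu + |q * (lam / mu)| by linarith) (abs_nonneg (plane α z))
    have : 0 ≤ M / (lam + mu) := by positivity
    linarith
  · intro x hx
    have := h.bottom x hx
    simp only [plane]
    rw [this, abs_mul]
    gcongr
    linarith
  · intro x hx
    have := h.diagonal x hx
    simp only [plane]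
    rw [this, abs_neg, abs_div, abs_of_pos hlm]
    gcongr
    exact hw 2

/-- The difference of two solutions solves the kernel equations up to errors of the size of the
difference of the parameters, so that the a priori estimate applies to it. -/
theorem IsKernel.exists_lipschitz {lam mu : ℝ} (hlam : 0 < lam) (hmu : 0 < mu) (q : ℝ) {M : ℝ}
    (hM : 0 ≤ M) :
    ∃ C > 0, ∀ (w₁ w₂ : Fin 4 → ℝ) (α₁ β₁ α₂ β₂ : C(triangle, ℝ)), (∀ i, |w₁ i| ≤ M) →
      (∀ i, |w₂ i| ≤ M) → IsKernel lam mu q w₁ α₁ β₁ → IsKernel lam mu q w₂ α₂ β₂ →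
      ‖α₁ - α₂‖ ≤ C * ‖w₁ - w₂‖ ∧ ‖β₁ - β₂‖ ≤ C * ‖w₁ - w₂‖ := by
  have hlm : 0 < lam + mu := by positivity
  obtain ⟨A, hA, hbound⟩ := IsKernel.exists_bound hlam hmu q hM
  set L := 2 * M + M / mu + |q * (lam / mu)| with hL
  have hMmu : 0 ≤ M / mu := by positivity
  have hq : 0 ≤ |q * (lam / mu)| := abs_nonneg _
  have hL1 : 2 * M ≤ L := by linarith
  have hL2 : M / mu ≤ L := by linarith
  have hL3 : |q * (lam / mu)| ≤ L := by linarith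
  have hL0 : 0 ≤ L := by linarith
  obtain ⟨C, hC, hest⟩ := apriori_estimate hlam hmu hL0
  set D := 3 * A + A / mu + 1 / (lam + mu) with hD
  have hAmu : 0 ≤ A / mu := by positivity
  have hlm' : 0 < 1 / (lam + mu) := by positivity
  have hD0 : 0 < D := by positivity
  refine ⟨C * D, by positivity, fun w₁ w₂ α₁ β₁ α₂ β₂ hw₁ hw₂ h₁ h₂ => ?_⟩
  set d := ‖w₁ - w₂‖ with hd
  have hd0 : 0 ≤ d := norm_nonneg _
  have hdi : ∀ i, |w₁ i - w₂ i| ≤ d := fun i => norm_le_pi_norm (w₁ - w₂) i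
  have key := hest (D * d) (fun z => plane α₁ z - plane α₂ z) (fun z => plane β₁ z - plane β₂ z)
    (by positivity) ((continuousOn_plane α₁).sub (continuousOn_plane α₂))
    ((continuousOn_plane β₁).sub (continuousOn_plane β₂))
    (fun z hz => (differentiableAt_plane h₁.contDiffOn_α hz).sub
      (differentiableAt_plane h₂.contDiffOn_α hz))
    (fun z hz => (differentiableAt_plane h₁.contDiffOn_β hz).sub
      (differentiableAt_plane h₂.contDiffOn_β hz)) ?_ ?_ ?_ ?_
  · have hnorm : ∀ u₁ u₂ : C(triangle, ℝ),
        (∀ z ∈ triangle, |plane u₁ z - plane u₂ z| ≤ C * (D * d)) → ‖u₁ - u₂‖ ≤ C * D * d := by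
      intro u₁ u₂ hu
      refine (ContinuousMap.norm_le _ (by positivity)).2 fun z => ?_
      have := hu z z.2
      rw [plane_coe, plane_coe, ← mul_assoc] at this
      exact this
    exact ⟨hnorm _ _ fun z hz => (key z hz).1, hnorm _ _ fun z hz => (key z hz).2⟩
  · intro z hz
    rw [fderiv_fun_sub (differentiableAt_plane h₁.contDiffOn_α hz)
      (differentiableAt_plane h₂.contDiffOn_α hz), _root_.sub_apply, h₁.fderiv_α hz,
      h₂.fderiv_α hz]
    obtain ⟨hA1, hA2⟩ := hbound w₂ α₂ β₂ hw₂ h₂ z (interior_subset hz)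
    set a₁ := plane α₁ z
    set a₂ := plane α₂ z
    set b₁ := plane β₁ z
    set b₂ := plane β₂ z
    have e : (w₁ 0 - w₁ 3) * a₁ + w₁ 2 * b₁ - ((w₂ 0 - w₂ 3) * a₂ + w₂ 2 * b₂) =
        (w₁ 0 - w₁ 3) * (a₁ - a₂) + w₁ 2 * (b₁ - b₂) +
          ((w₁ 0 - w₂ 0) - (w₁ 3 - w₂ 3)) * a₂ + (w₁ 2 - w₂ 2) * b₂ := by ring
    have e1 : |w₁ 0 - w₁ 3| ≤ L := by linarith [abs_sub (w₁ 0) (w₁ 3), hw₁ 0, hw₁ 3]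
    have e2 : |w₁ 2| ≤ L := by linarith [hw₁ 2]
    have e3 : |(w₁ 0 - w₂ 0) - (w₁ 3 - w₂ 3)| ≤ 2 * d := by
      linarith [abs_sub (w₁ 0 - w₂ 0) (w₁ 3 - w₂ 3), hdi 0, hdi 3]
    rw [e]
    calc |(w₁ 0 - w₁ 3) * (a₁ - a₂) + w₁ 2 * (b₁ - b₂) +
          ((w₁ 0 - w₂ 0) - (w₁ 3 - w₂ 3)) * a₂ + (w₁ 2 - w₂ 2) * b₂|
        ≤ |w₁ 0 - w₁ 3| * |a₁ - a₂| + |w₁ 2| * |b₁ - b₂| +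
          |(w₁ 0 - w₂ 0) - (w₁ 3 - w₂ 3)| * |a₂| + |w₁ 2 - w₂ 2| * |b₂| := by
          simp only [← abs_mul]
          exact (abs_add_le _ _).trans (add_le_add_left ((abs_add_le _ _).trans
            (add_le_add_left (abs_add_le _ _) _)) _)
      _ ≤ L * |a₁ - a₂| + L * |b₁ - b₂| + 2 * d * A + d * A := by
          gcongr
          exact hdi 2
      _ ≤ L * (|a₁ - a₂| + |b₁ - b₂|) + D * d := by
          have : 0 ≤ (A / mu + 1 / (lam + mu)) * d := by positivity
          rw [hD]
          linarith
  · intro z hz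
    rw [fderiv_fun_sub (differentiableAt_plane h₁.contDiffOn_β hz)
      (differentiableAt_plane h₂.contDiffOn_β hz), _root_.sub_apply]
    obtain ⟨hA1, -⟩ := hbound w₂ α₂ β₂ hw₂ h₂ z (interior_subset hz)
    have e₁ := h₁.fderiv_β hz
    have e₂ := h₂.fderiv_β hz
    set a₁ := plane α₁ z
    set a₂ := plane α₂ z
    have e : fderiv ℝ (plane β₁) z (1, 1) - fderiv ℝ (plane β₂) z (1, 1) =
        (w₁ 1 * (a₁ - a₂) + (w₁ 1 - w₂ 1) * a₂) / mu := by
      rw [eq_div_iff hmu.ne']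
      linarith
    rw [e, abs_div, abs_of_pos hmu]
    calc |w₁ 1 * (a₁ - a₂) + (w₁ 1 - w₂ 1) * a₂| / mu
        ≤ (|w₁ 1| * |a₁ - a₂| + |w₁ 1 - w₂ 1| * |a₂|) / mu := by
          simp only [← abs_mul]
          gcongr
          exact abs_add_le _ _
      _ ≤ (M * |a₁ - a₂| + d * A) / mu := by
          gcongr
          · exact hw₁ 1
          · exact hdi 1
      _ = M / mu * |a₁ - a₂| + A / mu * d := by ring
      _ ≤ L * |a₁ - a₂| + D * d := by
          gcongr
          linarith
  · intro x hx
    have e₁ := h₁.bottom x hx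
    have e₂ := h₂.bottom x hx
    simp only [plane]
    rw [e₁, e₂, ← mul_sub, abs_mul]
    gcongr
  · intro x hx
    have e₁ := h₁.diagonal x hx
    have e₂ := h₂.diagonal x hx
    simp only [plane]
    have e : -(w₁ 2 / (lam + mu)) - -(w₂ 2 / (lam + mu)) = -((w₁ 2 - w₂ 2) / (lam + mu)) := by ring
    rw [e₁, e₂, e, abs_neg, abs_div, abs_of_pos hlm]
    calc |w₁ 2 - w₂ 2| / (lam + mu) ≤ d / (lam + mu) := by
          gcongr
          exact hdi 2
      _ = 1 / (lam + mu) * d := by ring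
      _ ≤ D * d := by
          gcongr
          linarith

/-- Uniqueness is the Lipschitz estimate for equal parameters. -/
theorem IsKernel.unique {lam mu : ℝ} (hlam : 0 < lam) (hmu : 0 < mu) {q : ℝ} {w : Fin 4 → ℝ}
    {α₁ β₁ α₂ β₂ : C(triangle, ℝ)} (h₁ : IsKernel lam mu q w α₁ β₁)
    (h₂ : IsKernel lam mu q w α₂ β₂) : α₁ = α₂ ∧ β₁ = β₂ := by
  obtain ⟨C, -, hC⟩ := IsKernel.exists_lipschitz hlam hmu q (norm_nonneg w)
  have hw : ∀ i, |w i| ≤ ‖w‖ := fun i => norm_le_pi_norm w i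
  have h := hC w w α₁ β₁ α₂ β₂ hw hw h₁ h₂
  simp only [sub_self, norm_zero, mul_zero] at h
  exact ⟨sub_eq_zero.1 (norm_le_zero_iff.1 h.1), sub_eq_zero.1 (norm_le_zero_iff.1 h.2)⟩

/-- In the coordinates `u = x - ξ`, `v = ξ` the kernel equations become
`(lam + mu) α_u - lam α_v = (m₁ - m₄) α + m₃ β` and `mu β_v = m₂ α`. -/
theorem exists_isKernel {lam mu : ℝ} (hlam : 0 < lam) (hmu : 0 < mu) (q : ℝ) (w : Fin 4 → ℝ) :
    ∃ α β : C(triangle, ℝ), IsKernel lam mu q w α β := by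
  have hlm : 0 < lam + mu := by positivity
  obtain ⟨f, g, fu, fv, gu, gv, hf, hg, hfd, hgd, e1, e2, e3, e4⟩ :=
    exists_goursat_solution hlm.ne' lam (w 0 - w 3) (w 2) (w 1 / mu) (q * (lam / mu))
      (-(w 2 / (lam + mu)))
  let c : ℝ × ℝ → ℝ × ℝ := fun z => (z.1 - z.2, z.2)
  have hc : ContDiff ℝ 1 c := (contDiff_fst.sub contDiff_snd).prodMk contDiff_snd
  have hext : ∀ {F : ℝ × ℝ → ℝ} (hF : Continuous fun z : triangle => F (c z)) {x ξ : ℝ},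
      (x, ξ) ∈ triangle → ext ⟨_, hF⟩ x ξ = F (x - ξ, ξ) := by
    intro F hF x ξ hz
    exact dif_pos hz
  have hsmooth : ∀ {F : ℝ × ℝ → ℝ} (hF : Continuous fun z : triangle => F (c z)),
      ContDiff ℝ 1 F →
      ContDiffOn ℝ 1 (fun z : ℝ × ℝ => ext ⟨_, hF⟩ z.1 z.2) (interior triangle) := by
    intro F hF hF'
    exact (hF'.comp hc).contDiffOn.congr fun z hz => hext hF (interior_subset hz)
  have hderiv : ∀ {F Fu Fv : ℝ × ℝ → ℝ} (hF : Continuous fun z : triangle => F (c z)),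
      (∀ p, HasFDerivAt F (Fu p • ContinuousLinearMap.fst ℝ ℝ ℝ +
        Fv p • ContinuousLinearMap.snd ℝ ℝ ℝ) p) → ∀ {x ξ : ℝ}, (x, ξ) ∈ interior triangle →
      deriv (fun s => ext ⟨_, hF⟩ s ξ) x = Fu (x - ξ, ξ) ∧
        deriv (fun s => ext ⟨_, hF⟩ x s) ξ = Fv (x - ξ, ξ) - Fu (x - ξ, ξ) := by
    intro F Fu Fv hF hFd x ξ hz
    have hnhds := isOpen_interior.mem_nhds hz
    have hx : ∀ᶠ s in nhds x, (s, ξ) ∈ interior triangle :=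
      (Continuous.prodMk_left ξ).continuousAt.preimage_mem_nhds hnhds
    have hξ : ∀ᶠ s in nhds ξ, (x, s) ∈ interior triangle :=
      (Continuous.prodMk_right x).continuousAt.preimage_mem_nhds hnhds
    constructor
    · have h1 : HasDerivAt (fun s => F (s - ξ, ξ)) (Fu (x - ξ, ξ)) x := by
        convert! HasFDerivAt.comp_hasDerivAt (f := fun s : ℝ => (s - ξ, ξ)) x (hFd (x - ξ, ξ))
          (((hasDerivAt_id x).sub_const ξ).prodMk (hasDerivAt_const x ξ)) using 1
        simp
      refine (h1.congr_of_eventuallyEq ?_).deriv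
      filter_upwards [hx] with s hs using hext hF (interior_subset hs)
    · have h1 : HasDerivAt (fun s => F (x - s, s)) (Fv (x - ξ, ξ) - Fu (x - ξ, ξ)) ξ := by
        convert! HasFDerivAt.comp_hasDerivAt (f := fun s : ℝ => (x - s, s)) ξ (hFd (x - ξ, ξ))
          (((hasDerivAt_id ξ).const_sub x).prodMk (hasDerivAt_id ξ)) using 1
        simp
        ring
      refine (h1.congr_of_eventuallyEq ?_).deriv
      filter_upwards [hξ] with s hs using hext hF (interior_subset hs)
  have hfc : Continuous fun z : triangle => f (c z) :=
    hf.continuous.comp (hc.continuous.comp continuous_subtype_val)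
  have hgc : Continuous fun z : triangle => g (c z) :=
    hg.continuous.comp (hc.continuous.comp continuous_subtype_val)
  refine ⟨⟨_, hfc⟩, ⟨_, hgc⟩, hsmooth hfc hf, hsmooth hgc hg, ?_, ?_, ?_, ?_⟩
  · intro x ξ hz
    rw [(hderiv hfc hfd hz).1, (hderiv hfc hfd hz).2, hext hfc (interior_subset hz),
      hext hgc (interior_subset hz), ← e1]
    ring
  · intro x ξ hz
    rw [(hderiv hgc hgd hz).1, (hderiv hgc hgd hz).2, hext hfc (interior_subset hz), e2]
    field_simp
    ring
  · intro x hx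
    have hz : (x, (0 : ℝ)) ∈ triangle := ⟨le_rfl, hx.1, hx.2⟩
    rw [hext hfc hz, hext hgc hz, e3]
  · intro x hx
    have hz : (x, x) ∈ triangle := ⟨hx.1, le_rfl, hx.2⟩
    rw [hext hfc hz, sub_self, e4]

/-! ### Operator networks from universal approximation -/

/-- A continuous map on a compact set is uniformly close to a map with values in the span of
finitely many of its values, with coefficients that form a partition of unity. -/
theorem exists_partition_approx {X E : Type*} [TopologicalSpace X] [NormedAddCommGroup E]
    [NormedSpace ℝ E] {K : Set X} (hK : IsCompact K) {Φ : X → E} (hΦ : ContinuousOn Φ K) {ε : ℝ}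
    (hε : 0 < ε) :
    ∃ (p : ℕ) (h : Fin p → X → ℝ) (c : Fin p → E), (∀ k, ContinuousOn (h k) K) ∧
      (∀ k, ∀ w ∈ K, |h k w| ≤ 1) ∧ ∀ w ∈ K, ‖Φ w - ∑ k, h k w • c k‖ ≤ ε := by
  obtain ⟨t, -, htf, hcov⟩ := (hK.image_of_continuousOn hΦ).finite_cover_balls hε
  lift t to Finset E using htf
  let c : Fin t.card → E := fun k => t.equivFin.symm k
  let ρ : Fin t.card → X → ℝ := fun k w => max 0 (ε - ‖Φ w - c k‖)
  have hρ0 : ∀ k w, 0 ≤ ρ k w := fun k w => le_max_left _ _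
  have hρc : ∀ k, ContinuousOn (ρ k) K := fun k =>
    ContinuousOn.sup continuousOn_const
      (continuousOn_const.sub (hΦ.sub continuousOn_const).norm)
  have hpos : ∀ w ∈ K, 0 < ∑ k, ρ k w := by
    intro w hw
    obtain ⟨e, he, hwe⟩ := Set.mem_iUnion₂.1 (hcov ⟨w, hw, rfl⟩)
    refine Finset.sum_pos' (fun k _ => hρ0 k w) ⟨t.equivFin ⟨e, he⟩, Finset.mem_univ _, ?_⟩
    have : ‖Φ w - e‖ < ε := by rwa [Metric.mem_ball, dist_eq_norm] at hwe
    refine lt_max_of_lt_right ?_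
    simpa [c] using this
  refine ⟨t.card, fun k w => ρ k w / ∑ j, ρ j w, c, fun k => ?_, fun k w hw => ?_,
    fun w hw => ?_⟩
  · exact (hρc k).div (continuousOn_finsetSum _ fun j _ => hρc j) fun w hw => (hpos w hw).ne'
  · rw [abs_of_nonneg (div_nonneg (hρ0 k w) (hpos w hw).le), div_le_one (hpos w hw)]
    exact Finset.single_le_sum (f := fun j => ρ j w) (fun j _ => hρ0 j w) (Finset.mem_univ k)
  · have hsum : ∑ k, ρ k w / ∑ j, ρ j w = 1 := by
      rw [← Finset.sum_div, div_self (hpos w hw).ne']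
    have e : Φ w - ∑ k, (ρ k w / ∑ j, ρ j w) • c k =
        ∑ k, (ρ k w / ∑ j, ρ j w) • (Φ w - c k) := by
      simp only [smul_sub, Finset.sum_sub_distrib]
      rw [← Finset.sum_smul, hsum, one_smul]
    rw [e]
    calc ‖∑ k, (ρ k w / ∑ j, ρ j w) • (Φ w - c k)‖
        ≤ ∑ k, (ρ k w / ∑ j, ρ j w) * ε := by
          refine norm_sum_le_of_le _ fun k _ => ?_
          have h0 : 0 ≤ ρ k w / ∑ j, ρ j w := div_nonneg (hρ0 k w) (hpos w hw).le
          rw [norm_smul, Real.norm_of_nonneg h0]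
          -- a coefficient vanishes unless the corresponding value is `ε`-close
          rcases le_or_gt ‖Φ w - c k‖ ε with hle | hgt
          · gcongr
          · have : ρ k w = 0 := max_eq_left (by linarith)
            simp [this]
      _ = ε := by rw [← Finset.sum_mul, hsum, one_mul]

theorem isCompact_paramBox (b : Fin 4 → ℝ) : IsCompact (paramBox b) := by
  have : paramBox b = Set.univ.pi fun i => Set.Icc (-b i) (b i) := by
    ext w
    simp [paramBox, abs_le, Pi.le_def, forall_and]
  rw [this]
  exact isCompact_univ_pi fun i => isCompact_Icc

theorem abs_mul_sub_mul_le {h c g f B δ : ℝ} (hh : |h| ≤ 1) (hc : |c| ≤ B) (hδ : δ ≤ 1)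
    (hg : |h - g| ≤ δ) (hf : |c - f| ≤ δ) : |h * c - g * f| ≤ δ * (B + 2) := by
  have hδ0 : 0 ≤ δ := (abs_nonneg _).trans hg
  have e : h * c - g * f = h * (c - f) + (h - g) * f := by ring
  have hf' : |f| ≤ B + 1 := by
    have := abs_sub_abs_le_abs_sub f c
    rw [abs_sub_comm] at this
    linarith
  calc |h * c - g * f| ≤ |h| * |c - f| + |h - g| * |f| := by
        rw [e, ← abs_mul, ← abs_mul]
        exact abs_add_le _ _
    _ ≤ 1 * δ + δ * (B + 1) := by gcongr
    _ = δ * (B + 2) := by ring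

/-- Branch networks approximate the coefficients and trunk networks the vectors of a finite
expansion of `Φ`; the remaining terms of the DeepONet approximate zero. -/
theorem deepONetApproximable_of_isUniversal {G F : NetworkClass} (hG : G.IsUniversal)
    (hF : F.IsUniversal) {D : Set (Fin 4 → ℝ)} (hD : IsCompact D)
    {Φ : (Fin 4 → ℝ) → C(triangle, ℝ)} (hΦ : ContinuousOn Φ D) : DeepONetApproximable G F D Φ := by
  intro ε hε
  obtain ⟨p₀, h₀, c₀, hh₀, hb₀, happ⟩ := exists_partition_approx hD hΦ (half_pos hε)
  refine ⟨4, p₀, fun m hm p hp => ?_⟩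
  obtain ⟨r, rfl⟩ := Nat.exists_eq_add_of_le hp
  let h : Fin (p₀ + r) → (Fin 4 → ℝ) → ℝ := Fin.append h₀ fun _ _ => 0
  let c : Fin (p₀ + r) → C(triangle, ℝ) := Fin.append c₀ fun _ => 0
  have hh : ∀ k, ContinuousOn (h k) D := fun k =>
    Fin.addCases (fun i => by simpa [h] using hh₀ i) (fun i => by
      simpa [h] using continuousOn_const) k
  have hb : ∀ k, ∀ w ∈ D, |h k w| ≤ 1 := fun k =>
    Fin.addCases (fun i => by simpa [h] using hb₀ i) (fun i => by simp [h]) k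
  have hsum : ∀ w, ∑ k, h k w • c k = ∑ k, h₀ k w • c₀ k := fun w => by
    simp [Fin.sum_univ_add, h, c]
  set B := ∑ k, ‖c k‖
  have hB0 : 0 ≤ B := Finset.sum_nonneg fun k _ => norm_nonneg _
  have hcB : ∀ k z, |c k z| ≤ B := fun k z => ((c k).norm_coe_le_norm z).trans
    (Finset.single_le_sum (f := fun k => ‖c k‖) (fun k _ => norm_nonneg _) (Finset.mem_univ k))
  set N : ℝ := ((p₀ + r : ℕ) : ℝ) with hN
  have hN0 : 0 ≤ N := Nat.cast_nonneg _
  set δ := min 1 (ε / 2 / ((N + 1) * (B + 2))) with hδ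
  have hδ0 : 0 < δ := by positivity
  have hδN : N * (δ * (B + 2)) < ε / 2 := by
    have h1 : δ * ((N + 1) * (B + 2)) ≤ ε / 2 :=
      (le_div_iff₀ (by positivity)).1 (min_le_right _ _)
    have h2 : 0 < δ * (B + 2) := by positivity
    linarith
  let s : Fin m → Fin 4 := fun i => if hi : (i : ℕ) < 4 then ⟨i, hi⟩ else 0
  have hs : ∀ w : Fin 4 → ℝ, (fun j => (fun i => w (s i)) (Fin.castLE hm j)) = w := fun w => by
    ext j
    simp [s]
  have hbranch : ∀ k, ∃ g ∈ G m, ∀ w ∈ D, |h k w - g (fun i => w (s i))| < δ := by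
    intro k
    obtain ⟨g, hg, hgδ⟩ := hG m ((fun w i => w (s i)) '' D)
      (fun y => h k (fun j => y (Fin.castLE hm j))) (hD.image (by fun_prop))
      ((hh k).comp (by fun_prop) (by
        rintro _ ⟨w, hw, rfl⟩
        simpa only [hs w] using hw)) δ hδ0
    refine ⟨g, hg, fun w hw => ?_⟩
    have := hgδ _ ⟨w, hw, rfl⟩
    rwa [hs w] at this
  have htrunk : ∀ k, ∃ f ∈ F 2, ∀ z : triangle, |c k z - f ![z.1.1, z.1.2]| < δ := by
    intro k
    obtain ⟨f, hf, hfδ⟩ := hF 2 ((fun z : ℝ × ℝ => ![z.1, z.2]) '' triangle)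
      (fun y => plane (c k) (y 0, y 1)) (isCompact_triangle.image (by fun_prop))
      ((continuousOn_plane (c k)).comp (by fun_prop) (by
        rintro _ ⟨z, hz, rfl⟩
        simpa using hz)) δ hδ0
    refine ⟨f, hf, fun z => ?_⟩
    have := hfδ _ ⟨z, z.2, rfl⟩
    simpa [plane_coe] using this
  choose g hg hgδ using hbranch
  choose f hf hfδ using htrunk
  refine ⟨s, g, f, hg, hf, fun w hw z => ?_⟩
  have h1 : |Φ w z - ∑ k, h k w * c k z| ≤ ε / 2 := by
    have := ((Φ w - ∑ k, h k w • c k).norm_coe_le_norm z)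
    rw [hsum] at this
    have := this.trans (happ w hw)
    rw [← hsum] at this
    simpa using this
  have h2 : |∑ k, h k w * c k z - deepONet s g f w z.1.1 z.1.2| ≤ N * (δ * (B + 2)) := by
    rw [deepONet, ← Finset.sum_sub_distrib]
    refine (Finset.abs_sum_le_sum_abs _ _).trans ?_
    refine (Finset.sum_le_card_nsmul _ _ (δ * (B + 2)) fun k _ => ?_).trans_eq (by simp [hN])
    exact abs_mul_sub_mul_le (hb k w hw) (hcB k z) (min_le_left _ _) (hgδ k w hw).le (hfδ k z).le
  have h3 := abs_sub_le (Φ w z) (∑ k, h k w * c k z) (deepONet s g f w z.1.1 z.1.2)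
  linarith

/-! ### Density of shallow networks -/

open MeasureTheory Filter Topology

/-- The functions that elements of `S` approximate uniformly on every compact set. -/
def compactClosure {X : Type*} [TopologicalSpace X] (S : Submodule ℝ (X → ℝ)) :
    Submodule ℝ (X → ℝ) where
  carrier := {f | ∀ K, IsCompact K → ∀ ε : ℝ, 0 < ε → ∃ g ∈ S, ∀ x ∈ K, |f x - g x| < ε}
  zero_mem' := fun _ _ ε hε => ⟨0, S.zero_mem, fun x _ => by simpa using hε⟩
  add_mem' := by
    intro f₁ f₂ h₁ h₂ K hK ε hε
    obtain ⟨g₁, hg₁, hb₁⟩ := h₁ K hK (ε / 2) (half_pos hε)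
    obtain ⟨g₂, hg₂, hb₂⟩ := h₂ K hK (ε / 2) (half_pos hε)
    refine ⟨g₁ + g₂, S.add_mem hg₁ hg₂, fun x hx => ?_⟩
    have e : (f₁ + f₂) x - (g₁ + g₂) x = (f₁ x - g₁ x) + (f₂ x - g₂ x) := by
      simp only [Pi.add_apply]
      ring
    rw [e]
    linarith [abs_add_le (f₁ x - g₁ x) (f₂ x - g₂ x), hb₁ x hx, hb₂ x hx]
  smul_mem' := by
    intro t f h K hK ε hε
    obtain ⟨g, hg, hb⟩ := h K hK (ε / (|t| + 1)) (by positivity)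
    refine ⟨t • g, S.smul_mem t hg, fun x hx => ?_⟩
    have h1 := hb x hx
    rw [lt_div_iff₀ (by positivity)] at h1
    simp only [Pi.smul_apply, smul_eq_mul]
    rw [← mul_sub, abs_mul]
    nlinarith [abs_nonneg (f x - g x)]

section CompactClosure

variable {X Y : Type*} [TopologicalSpace X] [TopologicalSpace Y]

theorem le_compactClosure (S : Submodule ℝ (X → ℝ)) : S ≤ compactClosure S :=
  fun f hf _ _ ε hε => ⟨f, hf, fun x _ => by simpa using hε⟩

theorem mem_compactClosure_of_approx {S : Submodule ℝ (X → ℝ)} {f : X → ℝ}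
    (h : ∀ K, IsCompact K → ∀ ε : ℝ, 0 < ε → ∃ g ∈ compactClosure S, ∀ x ∈ K, |f x - g x| ≤ ε) :
    f ∈ compactClosure S := by
  intro K hK ε hε
  obtain ⟨g, hg, hfg⟩ := h K hK (ε / 2) (half_pos hε)
  obtain ⟨k, hk, hgk⟩ := hg K hK (ε / 2) (half_pos hε)
  refine ⟨k, hk, fun x hx => ?_⟩
  linarith [abs_sub_le (f x) (g x) (k x), hfg x hx, hgk x hx]

theorem comp_mem_compactClosure {S : Submodule ℝ (X → ℝ)} {T : Submodule ℝ (Y → ℝ)} {φ : Y → X}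
    (hφ : Continuous φ) (h : ∀ g ∈ S, g ∘ φ ∈ T) {f : X → ℝ} (hf : f ∈ compactClosure S) :
    f ∘ φ ∈ compactClosure T := by
  intro K hK ε hε
  obtain ⟨g, hg, hb⟩ := hf (φ '' K) (hK.image hφ) ε hε
  exact ⟨g ∘ φ, h g hg, fun y hy => hb _ ⟨y, hy, rfl⟩⟩

/-- The integral of a continuous family of elements of the closure is a limit of Riemann sums. -/
theorem integral_mem_compactClosure {S : Submodule ℝ (ℝ → ℝ)} {F : ℝ → ℝ → ℝ}
    (hF : Continuous fun p : ℝ × ℝ => F p.1 p.2) (hS : ∀ t, (fun x => F x t) ∈ compactClosure S)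
    {a b : ℝ} (hab : a ≤ b) : (fun x => ∫ t in a..b, F x t) ∈ compactClosure S := by
  refine mem_compactClosure_of_approx fun K hK ε hε => ?_
  have huc := (hK.prod (isCompact_Icc (a := a) (b := b))).uniformContinuousOn_of_continuous
    hF.continuousOn
  rw [Metric.uniformContinuousOn_iff] at huc
  obtain ⟨δ, hδ, hδF⟩ := huc (ε / (b - a + 1)) (div_pos hε (by linarith))
  obtain ⟨n, hn⟩ := exists_nat_gt ((b - a) / δ)
  have hn0 : (0 : ℝ) < n := lt_of_le_of_lt (div_nonneg (by linarith) hδ.le) hn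
  set η := (b - a) / n with hη
  have hη0 : 0 ≤ η := div_nonneg (by linarith) hn0.le
  have hηδ : η < δ := by
    rw [hη, div_lt_iff₀ hn0]
    rwa [div_lt_iff₀ hδ, mul_comm] at hn
  have hηn : n * η = b - a := by rw [hη]; field_simp
  let τ : ℕ → ℝ := fun i => a + i * η
  have hτs : ∀ i, τ (i + 1) = τ i + η := fun i => by simp only [τ]; push_cast; ring
  refine ⟨fun x => ∑ i ∈ Finset.range n, η * F x (τ i), ?_, fun x hx => ?_⟩
  · have : (fun x => ∑ i ∈ Finset.range n, η * F x (τ i)) =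
        ∑ i ∈ Finset.range n, η • fun x => F x (τ i) := by
      ext x
      simp
    rw [this]
    exact Submodule.sum_mem _ fun i _ => Submodule.smul_mem _ _ (hS _)
  · have hint : ∀ c d : ℝ, IntervalIntegrable (fun t => F x t) volume c d := fun c d =>
      (hF.comp (Continuous.prodMk_right x)).intervalIntegrable c d
    have hsum : ∫ t in a..b, F x t = ∑ i ∈ Finset.range n, ∫ t in τ i..τ (i + 1), F x t := by
      rw [intervalIntegral.sum_integral_adjacent_intervals fun i _ => hint _ _]
      congr 1
      · simp [τ]
      · simp [τ, hηn]
    rw [hsum, ← Finset.sum_sub_distrib]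
    have hterm : ∀ i ∈ Finset.range n,
        |(∫ t in τ i..τ (i + 1), F x t) - η * F x (τ i)| ≤ ε / (b - a + 1) * η := by
      intro i hi
      have hi1 : (i : ℝ) + 1 ≤ n := by exact_mod_cast Finset.mem_range.1 hi
      have hτa : a ≤ τ i := le_add_of_nonneg_right (by positivity)
      have hτb : τ (i + 1) ≤ b := by
        have := mul_le_mul_of_nonneg_right hi1 hη0
        simp only [τ]
        push_cast
        linarith
      have hle : τ i ≤ τ (i + 1) := by rw [hτs]; linarith
      have e : (∫ t in τ i..τ (i + 1), F x t) - η * F x (τ i) =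
          ∫ t in τ i..τ (i + 1), (F x t - F x (τ i)) := by
        rw [intervalIntegral.integral_sub (hint _ _) intervalIntegrable_const,
          intervalIntegral.integral_const, hτs, add_sub_cancel_left, smul_eq_mul]
      have h1 := intervalIntegral.norm_integral_le_of_norm_le_const (a := τ i) (b := τ (i + 1))
        (f := fun t => F x t - F x (τ i)) (C := ε / (b - a + 1)) (fun t ht => by
          rw [Set.uIoc_of_le hle] at ht
          refine (hδF (x, t) ⟨hx, by linarith [ht.1], by linarith [ht.2]⟩ (x, τ i)
            ⟨hx, hτa, by linarith⟩ ?_).le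
          rw [Prod.dist_eq, dist_self, Real.dist_eq, abs_of_pos (by linarith [ht.1])]
          exact max_lt hδ (by linarith [ht.2, hτs i]))
      rw [e, ← Real.norm_eq_abs]
      refine h1.trans_eq ?_
      rw [hτs, add_sub_cancel_left, abs_of_nonneg hη0]
    calc |∑ i ∈ Finset.range n, ((∫ t in τ i..τ (i + 1), F x t) - η * F x (τ i))|
        ≤ ∑ i ∈ Finset.range n, ε / (b - a + 1) * η :=
          (Finset.abs_sum_le_sum_abs _ _).trans (Finset.sum_le_sum hterm)
      _ = ε / (b - a + 1) * (b - a) := by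
          rw [Finset.sum_const, Finset.card_range, nsmul_eq_mul, ← hηn]
          ring
      _ ≤ ε := by
          rw [div_mul_eq_mul_div, div_le_iff₀ (by linarith)]
          nlinarith

end CompactClosure

/-- The span of the ridge functions `x ↦ σ (ℓ x + b)`, with `ℓ` a continuous linear functional;
for `X = Fin n → ℝ` these are the shallow networks with activation function `σ`. -/
def ridgeSpan (X : Type*) [NormedAddCommGroup X] [NormedSpace ℝ X] (σ : ℝ → ℝ) :
    Submodule ℝ (X → ℝ) :=
  Submodule.span ℝ {f | ∃ (ℓ : X →L[ℝ] ℝ) (b : ℝ), f = fun x => σ (ℓ x + b)}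

theorem ridge_comp_mem {X Y : Type*} [NormedAddCommGroup X] [NormedSpace ℝ X]
    [NormedAddCommGroup Y] [NormedSpace ℝ Y] {σ : ℝ → ℝ} (A : Y →L[ℝ] X) (v : X) {f : X → ℝ}
    (hf : f ∈ compactClosure (ridgeSpan X σ)) :
    (fun y => f (A y + v)) ∈ compactClosure (ridgeSpan Y σ) := by
  refine comp_mem_compactClosure (φ := fun y => A y + v) (by fun_prop) (fun g hg => ?_) hf
  induction hg using Submodule.span_induction with
  | mem g hg =>
    obtain ⟨ℓ, b, rfl⟩ := hg
    refine Submodule.subset_span ⟨ℓ.comp A, ℓ v + b, ?_⟩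
    ext y
    simp [add_assoc]
  | zero => exact Submodule.zero_mem _
  | add g₁ g₂ _ _ h₁ h₂ => exact Submodule.add_mem _ h₁ h₂
  | smul t g _ h => exact Submodule.smul_mem _ t h

theorem affine_comp_mem {σ f : ℝ → ℝ} (hf : f ∈ compactClosure (ridgeSpan ℝ σ)) (a b : ℝ) :
    (fun x => f (a * x + b)) ∈ compactClosure (ridgeSpan ℝ σ) :=
  ridge_comp_mem (a • ContinuousLinearMap.id ℝ ℝ) b hf

theorem self_mem_ridge (σ : ℝ → ℝ) : σ ∈ compactClosure (ridgeSpan ℝ σ) :=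
  le_compactClosure _ (Submodule.subset_span ⟨ContinuousLinearMap.id ℝ ℝ, 0, by simp⟩)

/-- Differentiating `f (a x + b)` repeatedly in the weight `a` stays in the closure: the difference
quotients converge uniformly on compact sets, by the mean value theorem. -/
theorem pow_mul_iteratedDeriv_mem {σ f : ℝ → ℝ} (hf : f ∈ compactClosure (ridgeSpan ℝ σ))
    (hs : ContDiff ℝ (⊤ : ℕ∞) f) (j : ℕ) (a b : ℝ) :
    (fun x => x ^ j * iteratedDeriv j f (a * x + b)) ∈ compactClosure (ridgeSpan ℝ σ) := by
  induction j generalizing a with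
  | zero => simpa using affine_comp_mem hf a b
  | succ j ih =>
    set g := iteratedDeriv j f
    set g' := iteratedDeriv (j + 1) f
    have hg' : ∀ y, HasDerivAt g (g' y) y := by
      intro y
      have : g' = deriv g := iteratedDeriv_succ
      rw [this]
      exact (hs.differentiable_iteratedDeriv j (by exact_mod_cast ENat.natCast_lt_top j)
        y).hasDerivAt
    have hc : Continuous g' := hs.continuous_iteratedDeriv (j + 1) (by exact_mod_cast le_top)
    refine mem_compactClosure_of_approx fun K hK ε hε => ?_
    obtain ⟨R, hR, hKR⟩ := hK.isBounded.subset_closedBall_lt 0 0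
    have hF : Continuous fun p : ℝ × ℝ => p.1 ^ (j + 1) * g' (p.2 * p.1 + b) := by fun_prop
    have huc := ((isCompact_closedBall (0 : ℝ) R).prod
      (isCompact_closedBall a 1)).uniformContinuousOn_of_continuous hF.continuousOn
    rw [Metric.uniformContinuousOn_iff] at huc
    obtain ⟨δ, hδ, hδF⟩ := huc ε hε
    set η := min 1 (δ / 2) with hηdef
    have hη : 0 < η := by positivity
    have hη1 : η ≤ 1 := min_le_left _ _
    have hηδ : η < δ := (min_le_right _ _).trans_lt (half_lt_self hδ)
    refine ⟨fun x => η⁻¹ * (x ^ j * g ((a + η) * x + b) - x ^ j * g (a * x + b)),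
      Submodule.smul_mem _ η⁻¹ (Submodule.sub_mem _ (ih (a + η)) (ih a)), fun x hx => ?_⟩
    have hder : ∀ s, HasDerivAt (fun s => x ^ j * g (s * x + b))
        (x ^ (j + 1) * g' (s * x + b)) s := by
      intro s
      have h1 : HasDerivAt (fun s => s * x + b) x s := by
        simpa using ((hasDerivAt_id s).mul_const x).add_const b
      convert! ((hg' (s * x + b)).comp s h1).const_mul (x ^ j) using 1
      ring
    obtain ⟨s, hs, hsl⟩ := exists_hasDerivAt_eq_slope (fun s => x ^ j * g (s * x + b)) _
      (show a < a + η by linarith) (fun s _ => (hder s).continuousAt.continuousWithinAt)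
      fun s _ => hder s
    have e : η⁻¹ * (x ^ j * g ((a + η) * x + b) - x ^ j * g (a * x + b)) =
        x ^ (j + 1) * g' (s * x + b) := by
      rw [hsl, add_sub_cancel_left]
      field_simp
    simp only [e]
    have hxR := hKR hx
    refine (hδF (x, a) ⟨hxR, by simp⟩ (x, s) ⟨hxR, ?_⟩ ?_).le
    · rw [Metric.mem_closedBall, Real.dist_eq, abs_of_pos (by linarith [hs.1])]
      linarith [hs.2]
    · rw [Prod.dist_eq, dist_self, dist_comm, Real.dist_eq, abs_of_pos (by linarith [hs.1])]
      exact max_lt hδ (by linarith [hs.2])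

/-- The polynomial functions of degree less than `k`. -/
def polyLT (k : ℕ) : Submodule ℝ (ℝ → ℝ) :=
  LinearMap.range (Fintype.linearCombination ℝ fun (i : Fin k) (x : ℝ) => x ^ (i : ℕ))

theorem mem_polyLT {k : ℕ} {f : ℝ → ℝ} :
    f ∈ polyLT k ↔ ∃ c : Fin k → ℝ, ∀ x, f x = ∑ i, c i * x ^ (i : ℕ) := by
  rw [polyLT, LinearMap.mem_range]
  refine exists_congr fun c => ?_
  rw [eq_comm, funext_iff]
  simp [Fintype.linearCombination_apply]

theorem isClosed_polyLT (k : ℕ) : IsClosed (polyLT k : Set (ℝ → ℝ)) := by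
  have : FiniteDimensional ℝ (polyLT k) := by
    unfold polyLT
    infer_instance
  exact Submodule.closed_of_finiteDimensional _

theorem mem_polyLT_of_iteratedDeriv_eq_zero {k : ℕ} {f : ℝ → ℝ} (hf : ContDiff ℝ (⊤ : ℕ∞) f)
    (h : ∀ x, iteratedDeriv k f x = 0) : f ∈ polyLT k := by
  induction k generalizing f with
  | zero => exact mem_polyLT.2 ⟨0, by simpa using h⟩
  | succ k ih =>
    have hd : ContDiff ℝ (⊤ : ℕ∞) (deriv f) := (contDiff_infty_iff_deriv.1 hf).2
    obtain ⟨c, hc⟩ := mem_polyLT.1 (ih hd fun x => by rw [← iteratedDeriv_succ']; exact h x)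
    have hder : ∀ x, HasDerivAt
        (fun x => f x - ∑ i : Fin k, c i / ((i : ℝ) + 1) * x ^ ((i : ℕ) + 1)) 0 x := by
      intro x
      have h1 : HasDerivAt (fun x => ∑ i : Fin k, c i / ((i : ℝ) + 1) * x ^ ((i : ℕ) + 1))
          (∑ i : Fin k, c i * x ^ (i : ℕ)) x := by
        refine HasDerivAt.fun_sum fun i _ => ?_
        convert! (hasDerivAt_pow ((i : ℕ) + 1) x).const_mul (c i / ((i : ℝ) + 1)) using 1
        have : ((i : ℕ) : ℝ) + 1 ≠ 0 := by positivity
        push_cast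
        field_simp
      have h2 := ((contDiff_infty_iff_deriv.1 hf).1 x).hasDerivAt.sub h1
      rwa [hc x, sub_self] at h2
    have hconst := is_const_of_deriv_eq_zero (fun x => (hder x).differentiableAt)
      fun x => (hder x).deriv
    refine mem_polyLT.2 ⟨Fin.cons (f 0) fun i => c i / ((i : ℝ) + 1), fun x => ?_⟩
    have := hconst x 0
    simp only [ne_eq, Nat.add_eq_zero_iff, one_ne_zero, and_false, not_false_eq_true, zero_pow,
      mul_zero, Finset.sum_const_zero, sub_zero] at this
    simp [Fin.sum_univ_succ, ← this]

/-- A mollification of `σ` is an integral of translates of `σ`. -/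
theorem convolution_mem_ridge {σ : ℝ → ℝ} (hσ : Continuous σ) (φ : ContDiffBump (0 : ℝ))
    (hφ : φ.rOut ≤ 1) :
    convolution (φ.normed volume) σ (ContinuousLinearMap.lsmul ℝ ℝ) volume ∈
      compactClosure (ridgeSpan ℝ σ) := by
  have e : convolution (φ.normed volume) σ (ContinuousLinearMap.lsmul ℝ ℝ) volume =
      fun x => ∫ t in (-1 : ℝ)..1, φ.normed volume t * σ (x - t) := by
    ext x
    rw [intervalIntegral.integral_eq_integral_of_support_subset]
    · simp [convolution]
    · intro t ht
      have h1 : t ∈ Function.support (φ.normed volume) := left_ne_zero_of_mul ht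
      rw [φ.support_normed_eq, Metric.mem_ball, Real.dist_eq, sub_zero, abs_lt] at h1
      exact ⟨by linarith [h1.1], by linarith [h1.2]⟩
  rw [e]
  have hc : Continuous (φ.normed volume) := φ.contDiff_normed (n := 0) |>.continuous
  refine integral_mem_compactClosure (F := fun x t => φ.normed volume t * σ (x - t))
    (by fun_prop) (fun t => Submodule.smul_mem _ _ ?_) (by norm_num)
  simpa [sub_eq_add_neg] using affine_comp_mem (self_mem_ridge σ) 1 (-t)

/-- If the `k`-th derivatives of all mollifications of `σ` vanished, `σ` would be a pointwise limit
of polynomials of degree less than `k`, hence such a polynomial. -/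
theorem exists_iteratedDeriv_ne_zero {σ : ℝ → ℝ} (hσ : Continuous σ)
    (hpoly : ¬ ∃ P : Polynomial ℝ, ∀ x, σ x = P.eval x) (k : ℕ) :
    ∃ f ∈ compactClosure (ridgeSpan ℝ σ), ContDiff ℝ (⊤ : ℕ∞) f ∧ ∃ b, iteratedDeriv k f b ≠ 0 := by
  by_contra! hcon
  let φ : ℕ → ContDiffBump (0 : ℝ) := fun n =>
    ⟨1 / ((n : ℝ) + 1) / 2, 1 / ((n : ℝ) + 1), by positivity, half_lt_self (by positivity)⟩
  have hmem : ∀ n, convolution ((φ n).normed volume) σ (ContinuousLinearMap.lsmul ℝ ℝ) volume ∈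
      polyLT k := by
    intro n
    have hsm : ContDiff ℝ (⊤ : ℕ∞)
        (convolution ((φ n).normed volume) σ (ContinuousLinearMap.lsmul ℝ ℝ) volume) :=
      (φ n).hasCompactSupport_normed.contDiff_convolution_left _ (φ n).contDiff_normed
        hσ.locallyIntegrable
    refine mem_polyLT_of_iteratedDeriv_eq_zero hsm (hcon _ (convolution_mem_ridge hσ _ ?_) hsm)
    exact div_le_one_of_le₀ (by linarith [(Nat.cast_nonneg n : (0 : ℝ) ≤ n)]) (by positivity)
  have hlim : Tendsto
      (fun n => convolution ((φ n).normed volume) σ (ContinuousLinearMap.lsmul ℝ ℝ) volume)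
      atTop (𝓝 σ) :=
    tendsto_pi_nhds.2 fun x => ContDiffBump.convolution_tendsto_right_of_continuous
      tendsto_one_div_add_atTop_nhds_zero_nat hσ x
  obtain ⟨c, hc⟩ := mem_polyLT.1
    ((isClosed_polyLT k).mem_of_tendsto hlim (Eventually.of_forall hmem))
  refine hpoly ⟨∑ i, Polynomial.C (c i) * Polynomial.X ^ (i : ℕ), fun x => ?_⟩
  simp [Polynomial.eval_finsetSum, hc x]

/-- The univariate density theorem: at weight `a = 0` the repeated derivatives
`x ^ k * f⁽ᵏ⁾ (a x + b)` are monomials, and Weierstrass' theorem applies. -/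
theorem continuous_mem_ridge {σ : ℝ → ℝ} (hσ : Continuous σ)
    (hpoly : ¬ ∃ P : Polynomial ℝ, ∀ x, σ x = P.eval x) {f : ℝ → ℝ} (hf : Continuous f) :
    f ∈ compactClosure (ridgeSpan ℝ σ) := by
  have hpow : ∀ k : ℕ, (fun x : ℝ => x ^ k) ∈ compactClosure (ridgeSpan ℝ σ) := by
    intro k
    obtain ⟨g, hg, hgs, b, hb⟩ := exists_iteratedDeriv_ne_zero hσ hpoly k
    have h := Submodule.smul_mem _ (iteratedDeriv k g b)⁻¹ (pow_mul_iteratedDeriv_mem hg hgs k 0 b)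
    convert! h using 1
    ext x
    simp
    field_simp
  have hP : ∀ P : Polynomial ℝ, (fun x => P.eval x) ∈ compactClosure (ridgeSpan ℝ σ) := by
    intro P
    have e : (fun x => P.eval x) =
        ∑ i ∈ Finset.range (P.natDegree + 1), P.coeff i • fun x : ℝ => x ^ i := by
      ext x
      simp [Polynomial.eval_eq_sum_range]
    rw [e]
    exact Submodule.sum_mem _ fun i _ => Submodule.smul_mem _ _ (hpow i)
  refine mem_compactClosure_of_approx fun K hK ε hε => ?_
  obtain ⟨R, hKR⟩ := hK.isBounded.subset_closedBall 0
  rw [Real.closedBall_eq_Icc] at hKR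
  obtain ⟨P, hPε⟩ := exists_polynomial_near_of_continuousOn _ _ f hf.continuousOn ε hε
  exact ⟨_, hP P, fun x hx => by rw [abs_sub_comm]; exact (hPε x (hKR hx)).le⟩

/-- In several variables the exponentials `exp ∘ ℓ`, `ℓ` linear, are ridge functions and span an
algebra that separates points, so that the theorem of Stone and Weierstrass applies. -/
theorem exists_ridge_near {n : ℕ} {σ : ℝ → ℝ}
    (hexp : Real.exp ∈ compactClosure (ridgeSpan ℝ σ)) {K : Set (Fin n → ℝ)} (hK : IsCompact K)
    {f : (Fin n → ℝ) → ℝ} (hf : ContinuousOn f K) {ε : ℝ} (hε : 0 < ε) :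
    ∃ g ∈ ridgeSpan (Fin n → ℝ) σ, ∀ x ∈ K, |f x - g x| < ε := by
  have : CompactSpace K := isCompact_iff_compactSpace.1 hK
  let M : Submonoid C(K, ℝ) :=
    { carrier := {e | ∃ ℓ : (Fin n → ℝ) →L[ℝ] ℝ, ∀ x : K, e x = Real.exp (ℓ x)}
      one_mem' := ⟨0, by simp⟩
      mul_mem' := by
        rintro e₁ e₂ ⟨ℓ₁, h₁⟩ ⟨ℓ₂, h₂⟩
        exact ⟨ℓ₁ + ℓ₂, fun x => by simp [h₁, h₂, Real.exp_add]⟩ }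
  have hsep : (Algebra.adjoin ℝ (M : Set C(K, ℝ))).SeparatesPoints := by
    intro x y hxy
    obtain ⟨i, hi⟩ := Function.ne_iff.1 (Subtype.coe_injective.ne hxy)
    let ℓ : (Fin n → ℝ) →L[ℝ] ℝ := ContinuousLinearMap.proj i
    let e : C(K, ℝ) := ⟨fun x => Real.exp (ℓ x), by fun_prop⟩
    exact ⟨e, ⟨e, Algebra.subset_adjoin ⟨ℓ, fun _ => rfl⟩, rfl⟩, fun h => hi (Real.exp_injective h)⟩
  obtain ⟨⟨g, hg⟩, hgε⟩ :=
    ContinuousMap.exists_mem_subalgebra_near_continuous_of_separatesPoints _ hsep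
      (fun x : K => f x) (continuousOn_iff_continuous_domRestrict.1 hf) (ε / 2) (half_pos hε)
  have hext : ∃ k ∈ compactClosure (ridgeSpan (Fin n → ℝ) σ), ∀ x : K, k x = g x := by
    have hg' : g ∈ Submodule.span ℝ (M : Set C(K, ℝ)) := by
      rwa [← Subalgebra.mem_toSubmodule, Algebra.adjoin_eq_span, Submonoid.closure_eq] at hg
    clear hgε hg
    induction hg' using Submodule.span_induction with
    | mem g hg =>
      obtain ⟨ℓ, hℓ⟩ := hg
      exact ⟨fun x => Real.exp (ℓ x), by simpa using ridge_comp_mem ℓ 0 hexp, fun x => (hℓ x).symm⟩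
    | zero => exact ⟨0, Submodule.zero_mem _, fun x => rfl⟩
    | add g₁ g₂ _ _ h₁ h₂ =>
      obtain ⟨k₁, hk₁, e₁⟩ := h₁
      obtain ⟨k₂, hk₂, e₂⟩ := h₂
      exact ⟨k₁ + k₂, Submodule.add_mem _ hk₁ hk₂, fun x => by simp [e₁, e₂]⟩
    | smul t g _ h =>
      obtain ⟨k, hk, e⟩ := h
      exact ⟨t • k, Submodule.smul_mem _ t hk, fun x => by simp [e]⟩
  obtain ⟨k, hk, hkg⟩ := hext
  obtain ⟨r, hr, hkr⟩ := hk K hK (ε / 2) (half_pos hε)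
  refine ⟨r, hr, fun x hx => ?_⟩
  have h1 := hgε ⟨x, hx⟩
  have h2 := hkr x hx
  rw [hkg ⟨x, hx⟩] at h2
  simp only [Real.norm_eq_abs] at h1
  rw [abs_sub_comm] at h1
  linarith [abs_sub_le (f x) (g ⟨x, hx⟩) (r x)]

theorem mem_shallowNetworks_of_mem_ridgeSpan {n : ℕ} {σ : ℝ → ℝ} {g : (Fin n → ℝ) → ℝ}
    (hg : g ∈ ridgeSpan (Fin n → ℝ) σ) : g ∈ shallowNetworks σ n := by
  obtain ⟨width, c, r, rfl⟩ := Submodule.mem_span_set'.1 hg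
  choose ℓ b hr using fun j => (r j).2
  refine ⟨width, c, b, fun j i => ℓ j (Pi.single i 1), fun x => ?_⟩
  rw [Finset.sum_apply]
  refine Finset.sum_congr rfl fun j _ => ?_
  rw [Pi.smul_apply, smul_eq_mul, hr j]
  have e : ℓ j x = ∑ i, ℓ j (Pi.single i 1) * x i := by
    conv_lhs => rw [pi_eq_sum_univ' x, map_sum]
    refine Finset.sum_congr rfl fun i _ => ?_
    rw [map_smul, smul_eq_mul, mul_comm]
  simp only [e]

/-- Shallow networks with a continuous non-polynomial activation function are universal. -/
theorem isUniversal_shallowNetworks {σ : ℝ → ℝ} (hσ : Continuous σ)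
    (hpoly : ¬ ∃ P : Polynomial ℝ, ∀ x, σ x = P.eval x) : (shallowNetworks σ).IsUniversal := by
  intro n K f hK hf ε hε
  obtain ⟨g, hg, h⟩ :=
    exists_ridge_near (continuous_mem_ridge hσ hpoly Real.continuous_exp) hK hf hε
  exact ⟨g, mem_shallowNetworks_of_mem_ridgeSpan hg, h⟩

/-! ### Kernel operators and their DeepONet approximation -/

theorem abs_le_sum_of_mem_paramBox {b w : Fin 4 → ℝ} (hw : w ∈ paramBox b) (i : Fin 4) :
    |w i| ≤ ∑ j, |b j| :=
  ((hw i).trans (le_abs_self _)).trans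
    (Finset.single_le_sum (f := fun j => |b j|) (fun _ _ => abs_nonneg _) (Finset.mem_univ i))

theorem continuousOn_of_norm_sub_le {X E : Type*} [SeminormedAddCommGroup X]
    [SeminormedAddCommGroup E] {Φ : X → E} {D : Set X} {C : ℝ}
    (h : ∀ w₁ ∈ D, ∀ w₂ ∈ D, ‖Φ w₁ - Φ w₂‖ ≤ C * ‖w₁ - w₂‖) : ContinuousOn Φ D := by
  refine (LipschitzOnWith.of_dist_le_mul (K := C.toNNReal) fun w₁ h₁ w₂ h₂ => ?_).continuousOn
  rw [dist_eq_norm, dist_eq_norm]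
  exact (h w₁ h₁ w₂ h₂).trans
    (mul_le_mul_of_nonneg_right (Real.le_coe_toNNReal C) (norm_nonneg _))

end BacksteppingKernel

open BacksteppingKernel in
theorem mainTheorem2 (lam mu q : ℝ) (hlam : 0 < lam) (hmu : 0 < mu) :
    ∃ Φα Φβ : (Fin 4 → ℝ) → C(triangle, ℝ),
      -- `(Φα w, Φβ w)` is the one and only solution of the kernel equations
      (∀ w α β, IsKernel lam mu q w α β ↔ α = Φα w ∧ β = Φβ w) ∧
      ∀ b : Fin 4 → ℝ,
        (∃ Cα > 0, ∀ w₁ ∈ paramBox b, ∀ w₂ ∈ paramBox b, w₁ ≠ w₂ →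
          ‖Φα w₁ - Φα w₂‖ < Cα * ‖w₁ - w₂‖) ∧
        (∃ Cβ > 0, ∀ w₁ ∈ paramBox b, ∀ w₂ ∈ paramBox b, w₁ ≠ w₂ →
          ‖Φβ w₁ - Φβ w₂‖ < Cβ * ‖w₁ - w₂‖) ∧
        (∀ G F : NetworkClass, G.IsUniversal → F.IsUniversal →
          DeepONetApproximable G F (paramBox b) Φα ∧
          DeepONetApproximable G F (paramBox b) Φβ) ∧
        (∀ σ τ : ℝ → ℝ, Continuous σ → Continuous τ →
          (¬ ∃ P : Polynomial ℝ, ∀ x, σ x = P.eval x) →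
          (¬ ∃ P : Polynomial ℝ, ∀ x, τ x = P.eval x) →
          DeepONetApproximable (shallowNetworks σ) (shallowNetworks τ) (paramBox b) Φα ∧
          DeepONetApproximable (shallowNetworks σ) (shallowNetworks τ) (paramBox b) Φβ) := by
  choose Φα Φβ hΦ using exists_isKernel hlam hmu q
  refine ⟨Φα, Φβ, fun w α β => ⟨fun h => h.unique hlam hmu (hΦ w), ?_⟩, fun b => ?_⟩
  · rintro ⟨rfl, rfl⟩
    exact hΦ w
  obtain ⟨C, hC, hlip⟩ := IsKernel.exists_lipschitz hlam hmu q
    (show 0 ≤ ∑ j, |b j| from Finset.sum_nonneg fun j _ => abs_nonneg _)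
  have hle : ∀ w₁ ∈ paramBox b, ∀ w₂ ∈ paramBox b,
      ‖Φα w₁ - Φα w₂‖ ≤ C * ‖w₁ - w₂‖ ∧ ‖Φβ w₁ - Φβ w₂‖ ≤ C * ‖w₁ - w₂‖ := fun w₁ h₁ w₂ h₂ =>
    hlip w₁ w₂ _ _ _ _ (abs_le_sum_of_mem_paramBox h₁) (abs_le_sum_of_mem_paramBox h₂)
      (hΦ w₁) (hΦ w₂)
  have hlt : ∀ w₁ w₂ : Fin 4 → ℝ, w₁ ≠ w₂ → C * ‖w₁ - w₂‖ < (C + 1) * ‖w₁ - w₂‖ :=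
    fun w₁ w₂ hne => mul_lt_mul_of_pos_right (lt_add_one C) (norm_pos_iff.2 (sub_ne_zero.2 hne))
  have happ : ∀ G F : NetworkClass, G.IsUniversal → F.IsUniversal →
      DeepONetApproximable G F (paramBox b) Φα ∧ DeepONetApproximable G F (paramBox b) Φβ :=
    fun G F hG hF =>
      ⟨deepONetApproximable_of_isUniversal hG hF (isCompact_paramBox b)
        (continuousOn_of_norm_sub_le fun w₁ h₁ w₂ h₂ => (hle w₁ h₁ w₂ h₂).1),
      deepONetApproximable_of_isUniversal hG hF (isCompact_paramBox b)
        (continuousOn_of_norm_sub_le fun w₁ h₁ w₂ h₂ => (hle w₁ h₁ w₂ h₂).2)⟩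
  exact ⟨⟨C + 1, by positivity, fun w₁ h₁ w₂ h₂ hne =>
      (hle w₁ h₁ w₂ h₂).1.trans_lt (hlt w₁ w₂ hne)⟩,
    ⟨C + 1, by positivity, fun w₁ h₁ w₂ h₂ hne =>
      (hle w₁ h₁ w₂ h₂).2.trans_lt (hlt w₁ w₂ hne)⟩,
    happ, fun σ τ hσ hτ hσp hτp =>
      happ _ _ (isUniversal_shallowNetworks hσ hσp) (isUniversal_shallowNetworks hτ hτp)⟩
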